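/- Let $N\ge 3$ be an odd integer, $q=e^{\pi i/N}$, $\{k\}=q^k-q^{-k}$, $[k]=\{k\}/\{1\}$, $[m]!=[m][m-1]\cdots[1]$ (with $[0]!=1$). Let $\overline{\mathcal U}_q(sl_2)$ be the $\mathbb C$-algebra generated by $K^{\pm1},E,F$ with relations $KEK^{-1}=q^2E$, $KFK^{-1}=q^{-2}F$, $EF-FE=\frac{K-K^{-1}}{q-q^{-1}}$, $E^N=F^N=0$, $K^{2N}=1$. Let $\mu$ be its right integral, i.e. the linear functional with value $\mu(E^{i}F^{m}K^{n})=\zeta\,\delta_{i,N-1}\delta_{m,N-1}\delta_{n,N+1}$ on the basis $E^iF^mK^n$ ($0\le i,m\le N-1$, $0\le n\le 2N-1$), where $\zeta=-\sqrt{2/N}\,([N-1]!)^2$, and let $\phi(x)=\mu(K^{N+1}x)$. Let $\overline{\mathcal U}_q(so_3)$ be the quotient of $\overline{\mathcal U}_q(sl_2)$ by the relation $K^N=1$, with projection $pr$, let $\iota:\overline{\mathcal U}_q(so_3)\to\overline{\mathcal U}_q(sl_2)$ be the (multiplicative, linear) inclusion $pr(x)\mapsto x\,\frac{K^N+1}{2}$,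 and let $\phi^{SO(3)}=\sqrt2\,\phi\circ\iota$. Let $\mathcal A$ be the $\mathbb C$-algebra generated by $k^{\pm1},e,f$ with relations $kek^{-1}=qe$, $kfk^{-1}=q^{-1}f$, $ef-fe=\frac{k^2-k^{-2}}{q-q^{-1}}$, $e^N=f^N=0$, $k^{4N}=1$; it contains $\overline{\mathcal U}_q(sl_2)$ through $E=e$, $F=f$, $K=k^2$. Let $$\overline R=\frac1{4N}\sum_{m=0}^{N-1}\sum_{n,j=0}^{4N-1}\frac{\{1\}^m}{[m]!}\,q^{\frac{m(m-1)}2+m(n-j)-\frac{nj}2}\,e^mk^n\otimes f^mk^j=\sum a\otimes b,\qquad \overline R^{-1}=\sum a'\otimes b',$$ and let $\tilde u_\pm=K^{N+1}u_\pm$ with $u_+=\sum b\,K^{1-N}a$ and $u_-=\sum a'\,K^{1-N}b'$ be the universal invariants of the unknots $U_\pm$ with framing $\pm1$. Then $\tilde u_\pm$ lie in $\overline{\mathcal U}_q(sl_2)$ and $\left|\phi^{SO(3)}(pr(\tilde u_\pm))\right|=1$. In particular $\phi^{SO(3)}(pr(\tilde u_+))$ and $\phi^{SO(3)}(pr(\tilde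 u_-))$ are not zero. -/

import Mathlib

open scoped TensorProduct

namespace SmallQuantum

noncomputable section

/-! ### The root of unity and quantum integers -/

/-- The power `q ^ x = exp (π i x / N)` of `q = exp (π i / N)`, for a complex exponent `x`. -/
def qpow (N : ℕ) (x : ℂ) : ℂ := Complex.exp (Real.pi * Complex.I * x / N)

/-- `{k} = q ^ k - q ^ (-k)`. -/
def qbrace (N : ℕ) (k : ℂ) : ℂ := qpow N k - qpow N (-k)

/-- `[k] = {k} / {1}`. -/
def qint (N : ℕ) (k : ℂ) : ℂ := qbrace N k / qbrace N 1

/-- `[m]! = [m] [m-1] ⋯ [1]`, with `[0]! = 1`. -/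
def qfact (N : ℕ) (m : ℕ) : ℂ := ∏ k ∈ Finset.Icc 1 m, qint N k

lemma qpow_add (N : ℕ) (x y : ℂ) : qpow N (x + y) = qpow N x * qpow N y := by
  rw [qpow, qpow, qpow, ← Complex.exp_add]; congr 1; ring

lemma qpow_zero (N : ℕ) : qpow N 0 = 1 := by simp [qpow]

lemma qpow_ne_zero (N : ℕ) (x : ℂ) : qpow N x ≠ 0 := Complex.exp_ne_zero _

lemma qpow_neg (N : ℕ) (x : ℂ) : qpow N (-x) = (qpow N x)⁻¹ := by
  rw [qpow, qpow, ← Complex.exp_neg]; congr 1; ring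

lemma qpow_nat_mul (N : ℕ) (n : ℕ) (x : ℂ) : qpow N (n * x) = qpow N x ^ n := by
  rw [qpow, qpow, ← Complex.exp_nat_mul]; congr 1; ring

lemma qpow_two_mul_self (N : ℕ) [NeZero N] : qpow N 1 ^ (2 * N) = 1 := by
  have hN : (N : ℂ) ≠ 0 := by exact_mod_cast NeZero.ne N
  have h : (Real.pi : ℂ) * Complex.I * (((2 * N : ℕ) : ℂ) * 1) / N = 2 * Real.pi * Complex.I := by
    push_cast
    field_simp
  rw [← qpow_nat_mul, qpow, h, Complex.exp_two_pi_mul_I]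

/-! ### The algebras -/

/-- Names of the generators of a presented algebra. -/
inductive Gen
  | E | F | K | Kinv

/-- The free algebra on the generators. -/
abbrev Free := FreeAlgebra ℂ Gen

/-- A generator in the free algebra. -/
abbrev gen (g : Gen) : Free := FreeAlgebra.ι ℂ g

/-- Defining relations of the restricted quantum group of `sl₂`. -/
inductive URel (N : ℕ) : Free → Free → Prop
  | K_Kinv : URel N (gen .K * gen .Kinv) 1
  | Kinv_K : URel N (gen .Kinv * gen .K) 1
  | K_E : URel N (gen .K * gen .E * gen .Kinv) (qpow N 2 • gen .E)
  | K_F : URel N (gen .K * gen .F * gen .Kinv) (qpow N (-2) • gen .F)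
  | E_F : URel N (gen .E * gen .F - gen .F * gen .E)
      ((qpow N 1 - qpow N (-1))⁻¹ • (gen .K - gen .Kinv))
  | E_pow : URel N (gen .E ^ N) 0
  | F_pow : URel N (gen .F ^ N) 0
  | K_pow : URel N (gen .K ^ (2 * N)) 1

/-- The restricted (small) quantum group of `sl₂` at `q = exp (π i / N)`, as an algebra. -/
abbrev U (N : ℕ) := RingQuot (URel N)

/-- The generators `E`, `F`, `K`, `K⁻¹` of `U N`. -/
def U.g (N : ℕ) (x : Gen) : U N := RingQuot.mkAlgHom ℂ (URel N) (gen x)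

/-- Defining relations of the extension of the restricted quantum group by a square root `k`
of `K`; here `gen .E`, `gen .F`, `gen .K`, `gen .Kinv` stand for `e`, `f`, `k`, `k⁻¹`. -/
inductive ARel (N : ℕ) : Free → Free → Prop
  | K_Kinv : ARel N (gen .K * gen .Kinv) 1
  | Kinv_K : ARel N (gen .Kinv * gen .K) 1
  | K_E : ARel N (gen .K * gen .E * gen .Kinv) (qpow N 1 • gen .E)
  | K_F : ARel N (gen .K * gen .F * gen .Kinv) (qpow N (-1) • gen .F)
  | E_F : ARel N (gen .E * gen .F - gen .F * gen .E)
      ((qpow N 1 - qpow N (-1))⁻¹ • (gen .K ^ 2 - gen .Kinv ^ 2))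
  | E_pow : ARel N (gen .E ^ N) 0
  | F_pow : ARel N (gen .F ^ N) 0
  | K_pow : ARel N (gen .K ^ (4 * N)) 1

/-- The algebra generated by `e`, `f`, `k`, which carries the universal `R`-matrix. -/
abbrev A (N : ℕ) := RingQuot (ARel N)

/-- The generators `e`, `f`, `k`, `k⁻¹` of `A N`. -/
def A.g (N : ℕ) (x : Gen) : A N := RingQuot.mkAlgHom ℂ (ARel N) (gen x)

section relations

lemma U.rel {N : ℕ} {a b : Free} (h : URel N a b) :
    RingQuot.mkAlgHom ℂ (URel N) a = RingQuot.mkAlgHom ℂ (URel N) b := RingQuot.mkAlgHom_rel ℂ h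

lemma A.rel {N : ℕ} {a b : Free} (h : ARel N a b) :
    RingQuot.mkAlgHom ℂ (ARel N) a = RingQuot.mkAlgHom ℂ (ARel N) b := RingQuot.mkAlgHom_rel ℂ h

variable (N : ℕ)

lemma U.K_Kinv : U.g N .K * U.g N .Kinv = 1 := by simpa [U.g] using U.rel (URel.K_Kinv (N := N))
lemma U.Kinv_K : U.g N .Kinv * U.g N .K = 1 := by simpa [U.g] using U.rel (URel.Kinv_K (N := N))
lemma U.K_E : U.g N .K * U.g N .E * U.g N .Kinv = qpow N 2 • U.g N .E := by
  simpa [U.g] using U.rel (URel.K_E (N := N))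
lemma U.K_F : U.g N .K * U.g N .F * U.g N .Kinv = qpow N (-2) • U.g N .F := by
  simpa [U.g] using U.rel (URel.K_F (N := N))
lemma U.E_F : U.g N .E * U.g N .F - U.g N .F * U.g N .E
    = (qpow N 1 - qpow N (-1))⁻¹ • (U.g N .K - U.g N .Kinv) := by
  simpa [U.g] using U.rel (URel.E_F (N := N))
lemma U.E_pow : U.g N .E ^ N = 0 := by simpa [U.g] using U.rel (URel.E_pow (N := N))
lemma U.F_pow : U.g N .F ^ N = 0 := by simpa [U.g] using U.rel (URel.F_pow (N := N))
lemma U.K_pow : U.g N .K ^ (2 * N) = 1 := by simpa [U.g] using U.rel (URel.K_pow (N := N))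

lemma A.K_Kinv : A.g N .K * A.g N .Kinv = 1 := by simpa [A.g] using A.rel (ARel.K_Kinv (N := N))
lemma A.Kinv_K : A.g N .Kinv * A.g N .K = 1 := by simpa [A.g] using A.rel (ARel.Kinv_K (N := N))
lemma A.K_E : A.g N .K * A.g N .E * A.g N .Kinv = qpow N 1 • A.g N .E := by
  simpa [A.g] using A.rel (ARel.K_E (N := N))
lemma A.K_F : A.g N .K * A.g N .F * A.g N .Kinv = qpow N (-1) • A.g N .F := by
  simpa [A.g] using A.rel (ARel.K_F (N := N))
lemma A.E_F : A.g N .E * A.g N .F - A.g N .F * A.g N .E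
    = (qpow N 1 - qpow N (-1))⁻¹ • (A.g N .K ^ 2 - A.g N .Kinv ^ 2) := by
  simpa [A.g] using A.rel (ARel.E_F (N := N))
lemma A.E_pow : A.g N .E ^ N = 0 := by simpa [A.g] using A.rel (ARel.E_pow (N := N))
lemma A.F_pow : A.g N .F ^ N = 0 := by simpa [A.g] using A.rel (ARel.F_pow (N := N))
lemma A.K_pow : A.g N .K ^ (4 * N) = 1 := by simpa [A.g] using A.rel (ARel.K_pow (N := N))

end relations

/-- Moving `E`, `F` past `K`: from `K x K⁻¹ = c x` to `K x = c x K`. -/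
lemma mul_of_conj {B : Type*} [Ring B] [Algebra ℂ B] {K Ki x : B} {c : ℂ}
    (h1 : Ki * K = 1) (h : K * x * Ki = c • x) : K * x = c • (x * K) := by
  calc K * x = K * x * (Ki * K) := by rw [h1, mul_one]
    _ = (K * x * Ki) * K := by noncomm_ring
    _ = _ := by rw [h, smul_mul_assoc]

lemma conj_of_mul {B : Type*} [Ring B] [Algebra ℂ B] {K Ki x : B} {c : ℂ}
    (h1 : K * Ki = 1) (h : K * x = c • (x * K)) : K * x * Ki = c • x := by
  rw [h, smul_mul_assoc, mul_assoc, h1, mul_one]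

lemma inv_mul_of_mul {B : Type*} [Ring B] [Algebra ℂ B] {K Ki x : B} {c : ℂ} (hc : c ≠ 0)
    (h1 : Ki * K = 1) (h2 : K * Ki = 1) (h : K * x = c • (x * K)) : Ki * x = c⁻¹ • (x * Ki) := by
  have : x * Ki = c • (Ki * x) := by
    calc x * Ki = Ki * (K * x) * Ki := by rw [← mul_assoc, h1, one_mul]
      _ = c • (Ki * x * (K * Ki)) := by rw [h]; simp [mul_assoc]
      _ = _ := by rw [h2, mul_one]
  rw [this, smul_smul, inv_mul_cancel₀ hc, one_smul]

/-- `K ^ 2` and `x`. -/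
lemma sq_mul_of_mul {B : Type*} [Ring B] [Algebra ℂ B] {K x : B} {c : ℂ}
    (h : K * x = c • (x * K)) : K ^ 2 * x = (c ^ 2) • (x * K ^ 2) := by
  rw [pow_two, mul_assoc, h, mul_smul_comm, ← mul_assoc, h, smul_mul_assoc, smul_smul, mul_assoc,
    pow_two]

/-- The straightening formula for `F * E ^ i`. -/
lemma straighten {B : Type*} [Ring B] [Algebra ℂ B] {E F K Ki : B} {κ c : ℂ}
    (hK : K * E = c • (E * K)) (hKi : Ki * E = c⁻¹ • (E * Ki))
    (h : E * F - F * E = κ • (K - Ki)) (i : ℕ) :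
    F * E ^ (i + 1) = E ^ (i + 1) * F
      - (κ * ∑ b ∈ Finset.range (i + 1), c ^ b) • (E ^ i * K)
      + (κ * ∑ b ∈ Finset.range (i + 1), c⁻¹ ^ b) • (E ^ i * Ki) := by
  have h' : F * E = E * F - κ • (K - Ki) := by rw [← h]; abel
  have key : ∀ {X : B} {d : ℂ}, X * E = d • (E * X) → ∀ j, X * E ^ j = d ^ j • (E ^ j * X) := by
    intro X d hX j
    induction j with
    | zero => simp
    | succ j ih =>
      rw [pow_succ, ← mul_assoc, ih, smul_mul_assoc, mul_assoc, hX, mul_smul_comm, smul_smul,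
        mul_assoc, pow_succ]
  induction i with
  | zero => simp [h', smul_sub]; abel
  | succ i ih =>
    rw [pow_succ' E (i + 1), ← mul_assoc, h', sub_mul, mul_assoc, ih, smul_mul_assoc, sub_mul,
      key hK, key hKi, Finset.sum_range_succ _ (i + 1), Finset.sum_range_succ _ (i + 1),
      pow_succ' E i]
    simp only [mul_add, mul_sub, add_smul, smul_sub, smul_smul, mul_smul_comm, mul_assoc]
    abel

lemma mul_pow_comm_of_straighten {B : Type*} [Ring B] [Algebra ℂ B] {E F K Ki : B} {κ c : ℂ}
    (hc : c ≠ 0) (h1 : Ki * K = 1) (h2 : K * Ki = 1) (hK : K * F = c • (F * K))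
    (h : E * F - F * E = κ • (K ^ 2 - Ki ^ 2)) (M : ℕ)
    (z1 : κ * ∑ b ∈ Finset.range (M + 1), (c ^ 2) ^ b = 0)
    (z2 : κ * ∑ b ∈ Finset.range (M + 1), (c ^ 2)⁻¹ ^ b = 0) :
    E * F ^ (M + 1) = F ^ (M + 1) * E := by
  have hKi2 := sq_mul_of_mul (inv_mul_of_mul hc h1 h2 hK)
  rw [inv_pow] at hKi2
  have hcomm : F * E - E * F = (-κ) • (K ^ 2 - Ki ^ 2) := by
    rw [neg_smul, ← h]; abel
  have hs := straighten (sq_mul_of_mul hK) hKi2 hcomm M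
  rw [neg_mul, neg_mul, z1, z2] at hs
  simpa using hs

/-! ### The regular representation of `A N` -/

/-- The vector space with basis indexed like the monomials `e ^ i f ^ m k ^ n`. -/
abbrev W (N : ℕ) := (Fin N × Fin N × ZMod (4 * N)) →₀ ℂ

/-- The vector of the monomial `e ^ i f ^ m k ^ n`. -/
def vec {N : ℕ} (i m : ℕ) (n : ZMod (4 * N)) : W N :=
  if h : i < N ∧ m < N then Finsupp.single (⟨i, h.1⟩, ⟨m, h.2⟩, n) 1 else 0

/-- Extend a function on monomials linearly. -/
def ext {N : ℕ} (φ : ℕ → ℕ → ZMod (4 * N) → W N) : Module.End ℂ (W N) :=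
  Finsupp.linearCombination ℂ fun x => φ x.1 x.2.1 x.2.2

lemma ext_vec {N : ℕ} (φ : ℕ → ℕ → ZMod (4 * N) → W N) (i m : ℕ) (n : ZMod (4 * N))
    (h : ¬ (i < N ∧ m < N) → φ i m n = 0) : ext φ (vec i m n) = φ i m n := by
  by_cases hh : i < N ∧ m < N
  · simp [ext, vec, hh]
  · simp [vec, hh, h hh]

lemma vec_zero {N : ℕ} {i m : ℕ} {n : ZMod (4 * N)} (h : ¬ (i < N ∧ m < N)) :
    vec i m n = (0 : W N) := by simp [vec, h]

lemma end_ext {N : ℕ} {S T : Module.End ℂ (W N)} (h : ∀ i m n, S (vec i m n) = T (vec i m n)) :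
    S = T := by
  refine Finsupp.lhom_ext' fun x => LinearMap.ext_ring ?_
  obtain ⟨i, m, n⟩ := x
  simpa [vec] using h i m n

/-- Left multiplication by `e`. -/
def opE (N : ℕ) : Module.End ℂ (W N) := ext fun i m n => vec (i + 1) m n

/-- Left multiplication by `k`. -/
def opK (N : ℕ) : Module.End ℂ (W N) :=
  ext fun i m n => (qpow N i * qpow N (-m)) • vec i m (n + 1)

/-- Left multiplication by `k⁻¹`. -/
def opKi (N : ℕ) : Module.End ℂ (W N) :=
  ext fun i m n => (qpow N (-i) * qpow N m) • vec i m (n - 1)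

/-- The coefficient in the straightening formula. -/
def coef (N : ℕ) (c : ℂ) (i : ℕ) : ℂ :=
  (qpow N 1 - qpow N (-1))⁻¹ * ∑ b ∈ Finset.range i, c ^ b

/-- Left multiplication by `f`. -/
def opF (N : ℕ) : Module.End ℂ (W N) :=
  ext fun i m n => vec i (m + 1) n
    - (coef N (qpow N 2) i * qpow N (-2 * m)) • vec (i - 1) m (n + 2)
    + (coef N (qpow N 2)⁻¹ i * qpow N (2 * m)) • vec (i - 1) m (n - 2)

lemma coef_self (N : ℕ) [NeZero N] (c : ℂ) (h : c = qpow N 2 ∨ c = (qpow N 2)⁻¹) :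
    coef N c N = 0 := by
  have h2 : qpow N 2 = qpow N 1 ^ 2 := by rw [← qpow_nat_mul]; norm_num
  have h0 := qpow_ne_zero N 1
  by_cases h1 : qpow N 2 = 1
  · have : qpow N 1 - qpow N (-1) = 0 := by
      rw [qpow_neg]
      rw [h2] at h1
      field_simp
      simp [h1]
    simp [coef, this]
  · have hc : c ≠ 1 := by
      rcases h with rfl | rfl
      · exact h1
      · simpa using h1
    have hcN : c ^ N = 1 := by
      have : qpow N 2 ^ N = 1 := by rw [h2, ← pow_mul, qpow_two_mul_self]
      rcases h with rfl | rfl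
      · exact this
      · rw [inv_pow, this, inv_one]
    rw [coef, geom_sum_eq hc, hcN]
    simp

lemma opE_vec (N i m : ℕ) (n : ZMod (4 * N)) : opE N (vec i m n) = vec (i + 1) m n :=
  ext_vec _ _ _ _ fun h => vec_zero (by omega)

lemma opK_vec (N i m : ℕ) (n : ZMod (4 * N)) :
    opK N (vec i m n) = (qpow N i * qpow N (-m)) • vec i m (n + 1) :=
  ext_vec _ _ _ _ fun h => by rw [vec_zero h, smul_zero]

lemma opKi_vec (N i m : ℕ) (n : ZMod (4 * N)) :
    opKi N (vec i m n) = (qpow N (-i) * qpow N m) • vec i m (n - 1) :=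
  ext_vec _ _ _ _ fun h => by rw [vec_zero h, smul_zero]

lemma opF_vec (N : ℕ) [NeZero N] (i m : ℕ) (n : ZMod (4 * N)) :
    opF N (vec i m n) = vec i (m + 1) n
    - (coef N (qpow N 2) i * qpow N (-2 * m)) • vec (i - 1) m (n + 2)
    + (coef N (qpow N 2)⁻¹ i * qpow N (2 * m)) • vec (i - 1) m (n - 2) := by
  refine ext_vec _ _ _ _ fun h => ?_
  by_cases hi : i = N
  · subst hi
    rw [coef_self i _ (Or.inl rfl), coef_self i _ (Or.inr rfl), vec_zero (by omega)]
    simp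
  · rw [vec_zero (by omega), vec_zero (n := n + 2) (by omega), vec_zero (by omega)]
    simp

lemma qpow_two_natCast (N i : ℕ) : qpow N (2 * i) = qpow N i ^ 2 := by
  rw [← qpow_nat_mul]; norm_num

lemma op_K_Kinv (N : ℕ) : opK N * opKi N = 1 := by
  refine end_ext fun i m n => ?_
  have h1 := qpow_ne_zero N i
  have h2 := qpow_ne_zero N m
  rw [Module.End.mul_apply, opKi_vec, map_smul, opK_vec, smul_smul, qpow_neg, qpow_neg]
  field_simp
  simp

lemma op_Kinv_K (N : ℕ) : opKi N * opK N = 1 := by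
  refine end_ext fun i m n => ?_
  have h1 := qpow_ne_zero N i
  have h2 := qpow_ne_zero N m
  rw [Module.End.mul_apply, opK_vec, map_smul, opKi_vec, smul_smul, qpow_neg, qpow_neg]
  field_simp
  simp

lemma op_K_E (N : ℕ) : opK N * opE N = qpow N 1 • (opE N * opK N) := by
  refine end_ext fun i m n => ?_
  simp only [Module.End.mul_apply, LinearMap.smul_apply, opK_vec, opE_vec, map_smul, smul_smul]
  push_cast
  rw [qpow_add]
  congr 1
  ring

lemma op_K_F (N : ℕ) [NeZero N] : opK N * opF N = qpow N (-1) • (opF N * opK N) := by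
  refine end_ext fun i m n => ?_
  simp only [Module.End.mul_apply, LinearMap.smul_apply, opK_vec, opF_vec, map_smul, smul_smul,
    map_add, map_sub, smul_add, smul_sub]
  have e1 : n + 2 + 1 = n + 1 + 2 := by ring
  have e2 : n - 2 + 1 = n + 1 - 2 := by ring
  rw [e1, e2]
  have h1 := qpow_ne_zero N 1
  congr 1
  · congr 1
    · congr 1
      push_cast
      rw [neg_add, qpow_add]; ring
    · rcases i with _ | i
      · simp [coef]
      · congr 1
        push_cast
        rw [qpow_add, qpow_neg N 1]
        field_simp
  · rcases i with _ | i
    · simp [coef]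
    · congr 1
      push_cast
      rw [qpow_add, qpow_neg N 1]
      field_simp

lemma op_E_F (N : ℕ) [NeZero N] : opE N * opF N - opF N * opE N
    = (qpow N 1 - qpow N (-1))⁻¹ • (opK N ^ 2 - opKi N ^ 2) := by
  refine end_ext fun i m n => ?_
  simp only [Module.End.mul_apply, LinearMap.smul_apply, LinearMap.sub_apply, pow_two, opK_vec,
    opKi_vec, opE_vec, opF_vec, map_smul, smul_smul, map_add, map_sub, smul_sub]
  have e1 : n + 1 + 1 = n + 2 := by ring
  have e2 : n - 1 - 1 = n - 2 := by ring
  rw [e1, e2, Nat.add_sub_cancel]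
  have hi : ∀ (c : ℂ) (d : ℂ) (l : ZMod (4 * N)),
      (coef N c i * d) • vec (i - 1 + 1) m l = (coef N c i * d) • (vec i m l : W N) := by
    intro c d l
    rcases i with _ | i
    · simp [coef]
    · rw [Nat.add_sub_cancel]
  rw [hi, hi]
  have h2 : qpow N 2 = qpow N 1 ^ 2 := by rw [← qpow_nat_mul]; norm_num
  have hq : qpow N 2 ^ i = qpow N i ^ 2 := by
    rw [← qpow_nat_mul, ← qpow_nat_mul]; congr 1; push_cast; ring
  have a1 : coef N (qpow N 2) (i + 1) * qpow N (-2 * m) = coef N (qpow N 2) i * qpow N (-2 * m)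
      + (qpow N 1 - qpow N (-1))⁻¹ * (qpow N i * qpow N (-m) * (qpow N i * qpow N (-m))) := by
    rw [coef, coef, Finset.sum_range_succ, hq, neg_mul, qpow_neg N (2 * m), qpow_two_natCast,
      qpow_neg N m]
    ring
  have a2 : coef N (qpow N 2)⁻¹ (i + 1) * qpow N (2 * m)
      = coef N (qpow N 2)⁻¹ i * qpow N (2 * m)
      + (qpow N 1 - qpow N (-1))⁻¹ * (qpow N (-i) * qpow N m * (qpow N (-i) * qpow N m)) := by
    rw [coef, coef, Finset.sum_range_succ, inv_pow, hq, qpow_two_natCast, qpow_neg N i]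
    ring
  rw [a1, a2, add_smul, add_smul]
  abel

lemma op_E_pow_vec (N j i m : ℕ) (n : ZMod (4 * N)) :
    (opE N ^ j) (vec i m n) = vec (i + j) m n := by
  induction j with
  | zero => simp
  | succ j ih => rw [pow_succ', Module.End.mul_apply, ih, opE_vec, add_assoc]

lemma op_F_pow_vec (N : ℕ) [NeZero N] (j m : ℕ) (n : ZMod (4 * N)) :
    (opF N ^ j) (vec 0 m n) = vec 0 (m + j) n := by
  induction j with
  | zero => simp
  | succ j ih =>
    rw [pow_succ', Module.End.mul_apply, ih, opF_vec]
    simp [coef, add_assoc]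

lemma op_K_pow_vec (N j i m : ℕ) (n : ZMod (4 * N)) :
    (opK N ^ j) (vec i m n) = ((qpow N i * qpow N (-m)) ^ j) • vec i m (n + (j : ZMod (4 * N))) := by
  induction j with
  | zero => simp
  | succ j ih =>
    rw [pow_succ', Module.End.mul_apply, ih, map_smul, opK_vec, smul_smul, pow_succ]
    push_cast
    rw [add_assoc]

lemma op_E_pow (N : ℕ) : opE N ^ N = 0 := by
  refine end_ext fun i m n => ?_
  rw [op_E_pow_vec, vec_zero (by omega)]
  simp

lemma op_K_pow (N : ℕ) [NeZero N] : opK N ^ (4 * N) = 1 := by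
  refine end_ext fun i m n => ?_
  have h : ∀ j : ℕ, qpow N j ^ (4 * N) = 1 := by
    intro j
    have : qpow N j = qpow N 1 ^ j := by rw [← qpow_nat_mul, mul_one]
    rw [this, ← pow_mul, show j * (4 * N) = 2 * N * (2 * j) by ring, pow_mul, qpow_two_mul_self,
      one_pow]
  rw [op_K_pow_vec, mul_pow, qpow_neg, inv_pow, h, h]
  simp

lemma op_F_pow (N : ℕ) [NeZero N] : opF N ^ N = 0 := by
  have h2 : qpow N (-1) ^ 2 = (qpow N 2)⁻¹ := by
    rw [← qpow_nat_mul, ← qpow_neg]; norm_num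
  obtain ⟨M, hM⟩ : ∃ M, N = M + 1 := ⟨N - 1, (Nat.succ_pred_eq_of_ne_zero (NeZero.ne N)).symm⟩
  have z1 := coef_self N _ (Or.inr rfl)
  have z2 := coef_self N _ (Or.inl rfl)
  rw [coef] at z1 z2
  have hs : opE N * opF N ^ (M + 1) = opF N ^ (M + 1) * opE N :=
    mul_pow_comm_of_straighten (B := Module.End ℂ (W N)) (qpow_ne_zero N _) (op_Kinv_K N)
      (op_K_Kinv N) (op_K_F N) (op_E_F N) M (by rw [h2, ← hM]; exact z1)
      (by rw [h2, inv_inv, ← hM]; exact z2)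
  rw [← hM] at hs
  have hs' : Commute (opE N) (opF N ^ N) := hs
  refine end_ext fun i m n => ?_
  have : vec i m n = (opE N ^ i) (vec 0 m n) := by rw [op_E_pow_vec, zero_add]
  rw [this, ← Module.End.mul_apply, ← (hs'.pow_left i).eq, Module.End.mul_apply, op_F_pow_vec,
    vec_zero (by omega)]
  simp

/-- The operators of the regular representation. -/
def op (N : ℕ) : Gen → Module.End ℂ (W N)
  | .E => opE N
  | .F => opF N
  | .K => opK N
  | .Kinv => opKi N

/-- The (left) regular representation of `A N`, on the span of the monomials
`e ^ i f ^ m k ^ n`. -/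
def reg (N : ℕ) [NeZero N] : A N →ₐ[ℂ] Module.End ℂ (W N) :=
  RingQuot.liftAlgHom ℂ ⟨FreeAlgebra.lift ℂ (op N), fun _ _ h => by
    cases h with
    | K_Kinv => simp [op, op_K_Kinv]
    | Kinv_K => simp [op, op_Kinv_K]
    | K_E => simpa [op] using conj_of_mul (B := Module.End ℂ (W N)) (op_K_Kinv N) (op_K_E N)
    | K_F => simpa [op] using conj_of_mul (B := Module.End ℂ (W N)) (op_K_Kinv N) (op_K_F N)
    | E_F => simpa [op] using op_E_F N
    | E_pow => simp [op, op_E_pow]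
    | F_pow => simp [op, op_F_pow]
    | K_pow => simp [op, op_K_pow]⟩

lemma reg_g (N : ℕ) [NeZero N] (x : Gen) : reg N (A.g N x) = op N x := by
  simp [reg, A.g]

/-! ### The inclusion `U N → A N` -/

/-- The images `e`, `f`, `k ^ 2`, `k ^ (-2)` of `E`, `F`, `K`, `K⁻¹`. -/
def inclGen (N : ℕ) : Gen → A N
  | .E => A.g N .E
  | .F => A.g N .F
  | .K => A.g N .K ^ 2
  | .Kinv => A.g N .Kinv ^ 2

/-- The inclusion of the restricted quantum group into `A N`: `E ↦ e`, `F ↦ f`, `K ↦ k ^ 2`. -/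
def incl (N : ℕ) : U N →ₐ[ℂ] A N :=
  RingQuot.liftAlgHom ℂ ⟨FreeAlgebra.lift ℂ (inclGen N), fun _ _ h => by
    have hc : Commute (A.g N .K) (A.g N .Kinv) := by
      rw [Commute, SemiconjBy, A.K_Kinv, A.Kinv_K]
    have h1 : A.g N .K ^ 2 * A.g N .Kinv ^ 2 = 1 := by rw [← hc.mul_pow, A.K_Kinv, one_pow]
    cases h with
    | K_Kinv => simpa [inclGen] using h1
    | Kinv_K => simpa [inclGen] using by rw [← hc.symm.mul_pow, A.Kinv_K, one_pow]
    | K_E =>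
      have := conj_of_mul h1 (sq_mul_of_mul (mul_of_conj (A.Kinv_K N) (A.K_E N)))
      rw [← qpow_nat_mul] at this
      simpa [inclGen] using this
    | K_F =>
      have := conj_of_mul h1 (sq_mul_of_mul (mul_of_conj (A.Kinv_K N) (A.K_F N)))
      rw [← qpow_nat_mul] at this
      simpa [inclGen] using this
    | E_F => simpa [inclGen] using A.E_F N
    | E_pow => simpa [inclGen] using A.E_pow N
    | F_pow => simpa [inclGen] using A.F_pow N
    | K_pow =>
      have := A.K_pow N
      rw [show 4 * N = 2 * (2 * N) by ring, pow_mul] at this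
      simpa [inclGen] using this⟩

lemma incl_g (N : ℕ) (x : Gen) : incl N (U.g N x) = inclGen N x := by
  simp [incl, U.g]

/-! ### The monomial basis of `U N` -/

/-- The monomials `E ^ i F ^ m K ^ n`. -/
def mono (N : ℕ) (x : Fin N × Fin N × Fin (2 * N)) : U N :=
  U.g N .E ^ (x.1 : ℕ) * U.g N .F ^ (x.2.1 : ℕ) * U.g N .K ^ (x.2.2 : ℕ)

/-- Apply an element of `U N` to the vector of the monomial `1`. -/
def act (N : ℕ) [NeZero N] : U N →ₗ[ℂ] W N :=
  (LinearMap.applyₗ (vec 0 0 0 : W N)) ∘ₗ (reg N).toLinearMap ∘ₗ (incl N).toLinearMap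

lemma act_mono_linearIndependent (N : ℕ) [NeZero N] : LinearIndependent ℂ (act N ∘ mono N) := by
  have hinj : Function.Injective (fun x : Fin N × Fin N × Fin (2 * N) =>
      ((x.1, x.2.1, ((2 * (x.2.2 : ℕ) : ℕ) : ZMod (4 * N))) : Fin N × Fin N × ZMod (4 * N))) := by
    rintro ⟨i, m, n⟩ ⟨i', m', n'⟩ h
    simp only [Prod.mk.injEq] at h
    obtain ⟨rfl, rfl, h⟩ := h
    have := (ZMod.natCast_eq_natCast_iff' _ _ _).1 h
    rw [Nat.mod_eq_of_lt (by omega), Nat.mod_eq_of_lt (by omega)] at this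
    have : n = n' := Fin.ext (by omega)
    rw [this]
  have hli := (Finsupp.linearIndependent_single_one ℂ
    (Fin N × Fin N × ZMod (4 * N))).comp _ hinj
  convert hli using 1
  funext ⟨i, m, n⟩
  simp only [Function.comp, act, mono, LinearMap.comp_apply, AlgHom.toLinearMap_apply, map_mul,
    map_pow, incl_g, inclGen, reg_g, op, LinearMap.applyₗ_apply_apply, Module.End.mul_apply]
  rw [← pow_mul, op_K_pow_vec]
  simp only [Nat.cast_zero, neg_zero, qpow_zero, mul_one, one_pow, one_smul]
  rw [op_F_pow_vec, op_E_pow_vec]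
  simp [vec]

lemma mono_linearIndependent (N : ℕ) [NeZero N] : LinearIndependent ℂ (mono N) :=
  (act_mono_linearIndependent N).of_comp (act N)

lemma mono_mem (N : ℕ) [NeZero N] (i m n : ℕ) :
    U.g N .E ^ i * U.g N .F ^ m * U.g N .K ^ n ∈ Submodule.span ℂ (Set.range (mono N)) := by
  by_cases hi : i < N
  · by_cases hm : m < N
    · refine Submodule.subset_span ⟨(⟨i, hi⟩, ⟨m, hm⟩, ⟨n % (2 * N), Nat.mod_lt _ ?_⟩), ?_⟩
      · have := NeZero.pos N; omega
      · rw [mono]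
        congr 1
        conv_rhs => rw [← Nat.mod_add_div n (2 * N), pow_add, pow_mul, U.K_pow, one_pow, mul_one]
    · rw [← Nat.sub_add_cancel (not_lt.1 hm), pow_add, U.F_pow]
      simp
  · rw [← Nat.sub_add_cancel (not_lt.1 hi), pow_add (U.g N .E), U.E_pow]
    simp

lemma U.K_mul_E (N : ℕ) : U.g N .K * U.g N .E = qpow N 2 • (U.g N .E * U.g N .K) :=
  mul_of_conj (U.Kinv_K N) (U.K_E N)

lemma U.K_mul_F (N : ℕ) : U.g N .K * U.g N .F = qpow N (-2) • (U.g N .F * U.g N .K) :=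
  mul_of_conj (U.Kinv_K N) (U.K_F N)

lemma U.Kinv_eq (N : ℕ) [NeZero N] : U.g N .Kinv = U.g N .K ^ (2 * N - 1) := by
  have hN := NeZero.pos N
  calc U.g N .Kinv = U.g N .Kinv * U.g N .K ^ (2 * N) := by rw [U.K_pow, mul_one]
    _ = U.g N .Kinv * (U.g N .K * U.g N .K ^ (2 * N - 1)) := by
      rw [← pow_succ', Nat.sub_add_cancel (by omega)]
    _ = _ := by rw [← mul_assoc, U.Kinv_K, one_mul]

lemma mul_pow_of_mul {B : Type*} [Ring B] [Algebra ℂ B] {K x : B} {c : ℂ}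
    (h : K * x = c • (x * K)) (i : ℕ) : K * x ^ i = c ^ i • (x ^ i * K) := by
  induction i with
  | zero => simp
  | succ j ih =>
    rw [pow_succ, ← mul_assoc, ih, smul_mul_assoc, mul_assoc, h, mul_smul_comm, smul_smul,
      mul_assoc, pow_succ]

lemma mul_mem_of_mono (N : ℕ) (x : U N)
    (h : ∀ i m n, x * (U.g N .E ^ i * U.g N .F ^ m * U.g N .K ^ n)
      ∈ Submodule.span ℂ (Set.range (mono N))) (y : U N)
    (hy : y ∈ Submodule.span ℂ (Set.range (mono N))) :
    x * y ∈ Submodule.span ℂ (Set.range (mono N)) := by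
  induction hy using Submodule.span_induction with
  | mem y hy => obtain ⟨z, rfl⟩ := hy; exact h _ _ _
  | zero => simp
  | add a b _ _ ha hb => rw [mul_add]; exact add_mem ha hb
  | smul c a _ ha => rw [mul_smul_comm]; exact Submodule.smul_mem _ _ ha

lemma K_mul_mem (N : ℕ) [NeZero N] (i m n : ℕ) :
    U.g N .K * (U.g N .E ^ i * U.g N .F ^ m * U.g N .K ^ n)
      ∈ Submodule.span ℂ (Set.range (mono N)) := by
  rw [mul_assoc, ← mul_assoc, mul_pow_of_mul (U.K_mul_E N), smul_mul_assoc, mul_assoc,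
    ← mul_assoc (U.g N .K), mul_pow_of_mul (U.K_mul_F N), smul_mul_assoc, mul_smul_comm,
    mul_assoc, ← pow_succ', ← mul_assoc]
  exact Submodule.smul_mem _ _ (Submodule.smul_mem _ _ (mono_mem N _ _ _))

lemma gen_mul_mem (N : ℕ) [NeZero N] (g : Gen) (y : U N)
    (hy : y ∈ Submodule.span ℂ (Set.range (mono N))) :
    U.g N g * y ∈ Submodule.span ℂ (Set.range (mono N)) := by
  have hKpow : ∀ (j : ℕ) (y : U N), y ∈ Submodule.span ℂ (Set.range (mono N)) →
      U.g N .K ^ j * y ∈ Submodule.span ℂ (Set.range (mono N)) := by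
    intro j
    induction j with
    | zero => intro y hy; simpa using hy
    | succ j ih =>
      intro y hy
      rw [pow_succ, mul_assoc]
      exact ih _ (mul_mem_of_mono N _ (K_mul_mem N) y hy)
  have hEpow : ∀ (j : ℕ) (y : U N), y ∈ Submodule.span ℂ (Set.range (mono N)) →
      U.g N .E ^ j * y ∈ Submodule.span ℂ (Set.range (mono N)) := by
    intro j y hy
    refine mul_mem_of_mono N _ (fun i m n => ?_) y hy
    rw [← mul_assoc, ← mul_assoc, ← pow_add]
    exact mono_mem N _ _ _
  cases g with
  | E => simpa using hEpow 1 y hy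
  | K => simpa using hKpow 1 y hy
  | Kinv => rw [U.Kinv_eq]; exact hKpow _ y hy
  | F =>
    refine mul_mem_of_mono N _ (fun i m n => ?_) y hy
    rcases i with _ | i
    · simpa [← mul_assoc, ← pow_succ'] using mono_mem N 0 (m + 1) n
    · have hs := straighten (U.K_mul_E N) (inv_mul_of_mul (qpow_ne_zero N 2) (U.Kinv_K N)
        (U.K_Kinv N) (U.K_mul_E N)) (U.E_F N) i
      rw [← mul_assoc, ← mul_assoc, hs]
      simp only [add_mul, sub_mul, smul_mul_assoc]
      refine add_mem (sub_mem ?_ (Submodule.smul_mem _ _ ?_)) (Submodule.smul_mem _ _ ?_)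
      · rw [mul_assoc (U.g N .E ^ (i + 1)), ← pow_succ']
        exact mono_mem N _ _ _
      · simp only [mul_assoc]
        refine hEpow _ _ ?_
        simpa using K_mul_mem N 0 m n
      · simp only [mul_assoc]
        refine hEpow _ _ ?_
        rw [U.Kinv_eq]
        refine hKpow _ _ ?_
        simpa using mono_mem N 0 m n

lemma mono_span (N : ℕ) [NeZero N] : ⊤ ≤ Submodule.span ℂ (Set.range (mono N)) := by
  have key : ∀ (a : Free) (y : U N), y ∈ Submodule.span ℂ (Set.range (mono N)) →
      RingQuot.mkAlgHom ℂ (URel N) a * y ∈ Submodule.span ℂ (Set.range (mono N)) := by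
    intro a
    induction a using FreeAlgebra.induction with
    | grade0 r =>
      intro y hy
      rw [AlgHom.commutes, ← Algebra.smul_def]
      exact Submodule.smul_mem _ _ hy
    | grade1 g => intro y hy; exact gen_mul_mem N g y hy
    | mul a b ha hb => intro y hy; rw [map_mul, mul_assoc]; exact ha _ (hb _ hy)
    | add a b ha hb => intro y hy; rw [map_add, add_mul]; exact add_mem (ha _ hy) (hb _ hy)
  intro x _
  obtain ⟨a, rfl⟩ := RingQuot.mkAlgHom_surjective ℂ (URel N) x
  have h1 : (1 : U N) ∈ Submodule.span ℂ (Set.range (mono N)) := by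
    simpa using mono_mem N 0 0 0
  simpa using key a 1 h1

/-- The basis `E ^ i F ^ m K ^ n` (`0 ≤ i, m < N`, `0 ≤ n < 2 N`) of `U N`. -/
def monoBasis (N : ℕ) [NeZero N] : Module.Basis (Fin N × Fin N × Fin (2 * N)) ℂ (U N) :=
  Module.Basis.mk (mono_linearIndependent N) (mono_span N)

lemma monoBasis_apply (N : ℕ) [NeZero N] (x : Fin N × Fin N × Fin (2 * N)) :
    monoBasis N x = U.g N .E ^ (x.1 : ℕ) * U.g N .F ^ (x.2.1 : ℕ) * U.g N .K ^ (x.2.2 : ℕ) := by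
  rw [monoBasis, Module.Basis.mk_apply, mono]

/-- `incl` is indeed an inclusion. -/
lemma incl_injective (N : ℕ) [NeZero N] : Function.Injective (incl N) := by
  have h : Function.Injective (act N) := by
    have h1 : LinearIndependent ℂ (act N ∘ monoBasis N) := by
      convert act_mono_linearIndependent N using 2
      funext x
      rw [monoBasis_apply, mono]
    rw [← LinearMap.ker_eq_bot, LinearMap.ker_eq_bot']
    intro x hx
    rw [← (monoBasis N).sum_repr x] at hx ⊢
    rw [map_sum] at hx
    simp only [map_smul] at hx
    have := Fintype.linearIndependent_iff.1 h1 _ hx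
    simp [this]
  intro x y hxy
  apply h
  simp [act, hxy]

/-! ### The right integral and the symmetric linear function -/

/-- The normalization `ζ = - √(2/N) ([N-1]!)²`. -/
def zeta (N : ℕ) : ℂ := -(Real.sqrt (2 / N) : ℂ) * qfact N (N - 1) ^ 2

/-- The right integral: `μ (E ^ i F ^ m K ^ n) = ζ` if `i = m = N - 1`, `n = N + 1`, and `0` for the
other elements of the monomial basis. -/
def mu (N : ℕ) [NeZero N] : U N →ₗ[ℂ] ℂ :=
  (monoBasis N).constr ℂ fun x =>
    if (x.1 : ℕ) = N - 1 ∧ (x.2.1 : ℕ) = N - 1 ∧ (x.2.2 : ℕ) = N + 1 then zeta N else 0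

lemma mu_mono (N : ℕ) [NeZero N] (i m : Fin N) (n : Fin (2 * N)) :
    mu N (U.g N .E ^ (i : ℕ) * U.g N .F ^ (m : ℕ) * U.g N .K ^ (n : ℕ))
      = if (i : ℕ) = N - 1 ∧ (m : ℕ) = N - 1 ∧ (n : ℕ) = N + 1 then zeta N else 0 := by
  rw [← monoBasis_apply N (i, m, n), mu, Module.Basis.constr_basis]

/-- The symmetric linear function `φ x = μ (K ^ (N+1) x)`. -/
def phi (N : ℕ) [NeZero N] : U N →ₗ[ℂ] ℂ :=
  mu N ∘ₗ LinearMap.mulLeft ℂ (U.g N .K ^ (N + 1))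

/-! ### The `so₃` version -/

/-- The two-sided ideal generated by `K ^ N - 1`. -/
abbrev soIdeal (N : ℕ) : Ideal (U N) := (TwoSidedIdeal.span {U.g N .K ^ N - 1}).asIdeal

/-- The quotient of `U N` by the relation `K ^ N = 1`. -/
abbrev USo (N : ℕ) := U N ⧸ soIdeal N

/-- The canonical projection. -/
def pr (N : ℕ) : U N →ₐ[ℂ] USo N := Ideal.Quotient.mkₐ ℂ (soIdeal N)

/-- The element `(K ^ N + 1) / 2` of `U N`. -/
def halfIdem (N : ℕ) : U N := (2 : ℂ)⁻¹ • (U.g N .K ^ N + 1)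

lemma K_pow_central (N : ℕ) [NeZero N] (x : U N) : Commute (U.g N .K ^ N) x := by
  have hpow : ∀ {c : ℂ} {y : U N}, U.g N .K * y = c • (y * U.g N .K) → c ^ N = 1 →
      Commute (U.g N .K ^ N) y := by
    intro c y h hc
    have : ∀ j : ℕ, U.g N .K ^ j * y = c ^ j • (y * U.g N .K ^ j) := by
      intro j
      induction j with
      | zero => simp
      | succ j ih =>
        rw [pow_succ', mul_assoc, ih, mul_smul_comm, ← mul_assoc, h, smul_mul_assoc, smul_smul,
          mul_assoc, pow_succ]
    rw [Commute, SemiconjBy, this N, hc, one_smul]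
  have h2 : qpow N 2 ^ N = 1 := by
    rw [← qpow_two_mul_self N, ← qpow_nat_mul, ← qpow_nat_mul]; congr 1; push_cast; ring
  obtain ⟨a, rfl⟩ := RingQuot.mkAlgHom_surjective ℂ (URel N) x
  induction a using FreeAlgebra.induction with
  | grade0 r => rw [AlgHom.commutes]; exact Algebra.commute_algebraMap_right r _
  | grade1 g =>
    change Commute (U.g N .K ^ N) (U.g N g)
    cases g with
    | E => exact hpow (U.K_mul_E N) h2
    | F => exact hpow (U.K_mul_F N) (by rw [qpow_neg, inv_pow, h2, inv_one])
    | K => exact (Commute.refl _).pow_left N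
    | Kinv => rw [U.Kinv_eq]; exact Commute.pow_pow_self _ _ _
  | mul a b ha hb => rw [map_mul]; exact ha.mul_right hb
  | add a b ha hb => rw [map_add]; exact ha.add_right hb

lemma halfIdem_central (N : ℕ) [NeZero N] (x : U N) : Commute (halfIdem N) x :=
  ((K_pow_central N x).add_left (Commute.one_left x)).smul_left _

lemma K_pow_mul_halfIdem (N : ℕ) : U.g N .K ^ N * halfIdem N = halfIdem N := by
  rw [halfIdem, mul_smul_comm, mul_add, ← pow_add, mul_one, ← two_mul, U.K_pow, add_comm]

lemma halfIdem_mul_self (N : ℕ) : halfIdem N * halfIdem N = halfIdem N := by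
  conv_lhs => enter [1]; rw [halfIdem]
  rw [smul_mul_assoc, add_mul, K_pow_mul_halfIdem, one_mul, ← two_smul ℂ, smul_smul]
  norm_num

lemma mul_halfIdem_eq_zero (N : ℕ) [NeZero N] (x : U N) (hx : x ∈ soIdeal N) :
    x * halfIdem N = 0 := by
  have hx' : x ∈ TwoSidedIdeal.span {U.g N .K ^ N - 1} := hx
  induction hx' using TwoSidedIdeal.span_induction with
  | mem x h =>
    rw [Set.mem_singleton_iff.1 h, sub_mul, K_pow_mul_halfIdem, one_mul, sub_self]
  | zero => simp
  | add x y _ _ h1 h2 => rw [add_mul, h1 ‹_›, h2 ‹_›, add_zero]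
  | neg x hx' h =>
    have h0 := h hx'
    exact (neg_mul x (halfIdem N)).trans (by rw [h0, neg_zero])
  | left_absorb a x _ h => rw [mul_assoc, h ‹_›, mul_zero]
  | right_absorb b x _ h => rw [mul_assoc, ← (halfIdem_central N b).eq, ← mul_assoc, h ‹_›, zero_mul]

/-- The inclusion of the `so₃` quotient into `U N` as a direct factor, which sends the class of `x`
to `x (K ^ N + 1) / 2`; in particular `E ↦ E (K ^ N + 1) / 2`, `F ↦ F (K ^ N + 1) / 2` and
`K ↦ K (K ^ N + 1) / 2`. It preserves products, and sends `1` to the idempotent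
`(K ^ N + 1) / 2`. -/
def inclSo (N : ℕ) [NeZero N] : USo N →ₙₐ[ℂ] U N where
  toFun := (soIdeal N).liftQ (LinearMap.toSpanSingleton (U N) (U N) (halfIdem N))
    fun x hx => by simpa using mul_halfIdem_eq_zero N x hx
  map_smul' c x := by
    obtain ⟨x, rfl⟩ := Ideal.Quotient.mk_surjective x
    change (c • x) * halfIdem N = c • (x * halfIdem N)
    rw [smul_mul_assoc]
  map_zero' := map_zero _
  map_add' := map_add _
  map_mul' x y := by
    obtain ⟨x, rfl⟩ := Ideal.Quotient.mk_surjective x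
    obtain ⟨y, rfl⟩ := Ideal.Quotient.mk_surjective y
    change (x * y) * halfIdem N = (x * halfIdem N) * (y * halfIdem N)
    rw [mul_assoc x (halfIdem N), ← mul_assoc (halfIdem N) y, (halfIdem_central N y).eq,
      mul_assoc y, halfIdem_mul_self, mul_assoc]

lemma inclSo_pr_g (N : ℕ) [NeZero N] (g : Gen) :
    inclSo N (pr N (U.g N g)) = U.g N g * ((2 : ℂ)⁻¹ • (U.g N .K ^ N + 1)) := rfl

lemma inclSo_pr (N : ℕ) [NeZero N] (x : U N) : inclSo N (pr N x) = x * halfIdem N := rfl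

/-- `φ^{SO(3)} = √2 φ ∘ ι`. -/
def phiSO3 (N : ℕ) [NeZero N] : USo N →ₗ[ℂ] ℂ where
  toFun u := Real.sqrt 2 * phi N (inclSo N u)
  map_add' x y := by rw [map_add, map_add, mul_add]
  map_smul' c x := by
    have h : inclSo N (c • x) = c • inclSo N x := (inclSo N).map_smul' c x
    rw [h, map_smul, smul_eq_mul, smul_eq_mul, RingHom.id_apply]
    ring

/-! ### The universal invariants of the unknots with framing `±1` -/

/-- The universal `R`-matrix of `A N`. -/
def R (N : ℕ) : A N ⊗[ℂ] A N :=
  (4 * N : ℂ)⁻¹ • ∑ m ∈ Finset.range N, ∑ n ∈ Finset.range (4 * N), ∑ j ∈ Finset.range (4 * N),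
    (qbrace N 1 ^ m / qfact N m *
        qpow N ((m : ℂ) * (m - 1) / 2 + m * ((n : ℂ) - j) - (n : ℂ) * j / 2)) •
      ((A.g N .E ^ m * A.g N .K ^ n) ⊗ₜ[ℂ] (A.g N .F ^ m * A.g N .K ^ j))

/-- The universal invariant of the `(1,1)`-tangle obtained from the standard closure (on the right) of
a 2-strand braid with one crossing, by opening the left strand. The crossing carries
`∑ x ⊗ y`, with `x` at the lower left and `y` at the lower right end, and the closing arc on the
right contributes `K ^ (1 - N) = k ^ (- 2 (N - 1))`. Walking along the strand
from the top left one meets `y`, then `K ^ (1 - N)`, then `x`. -/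
def tangleInv (N : ℕ) : A N ⊗[ℂ] A N →ₗ[ℂ] A N :=
  TensorProduct.lift
    (((LinearMap.mul ℂ (A N)).comp (LinearMap.mulRight ℂ ((A.g N .Kinv ^ 2) ^ (N - 1)))).flip)

lemma tangleInv_tmul (N : ℕ) (x y : A N) :
    tangleInv N (x ⊗ₜ y) = y * (A.g N .Kinv ^ 2) ^ (N - 1) * x := by
  simp [tangleInv]

/-- The invariant `u₊` of the `(1,1)`-tangle of the unknot with framing `+1`: the crossing carries
`R = ∑ a ⊗ b`, so that `u₊ = ∑ b K ^ (1-N) a`. -/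
def uPlus (N : ℕ) : A N := tangleInv N (R N)

/-- The invariant `u₋` of the `(1,1)`-tangle of the unknot with framing `-1`: the crossing carries
`∑ b' ⊗ a'` where `R⁻¹ = ∑ a' ⊗ b'`, so that `u₋ = ∑ a' K ^ (1-N) b'`. -/
def uMinus (N : ℕ) : A N :=
  tangleInv N (TensorProduct.comm ℂ (A N) (A N) (Ring.inverse (R N)))

/-- The universal invariant `K ^ (N+1) u₊` of the unknot with framing `+1`. -/
def uTildePlus (N : ℕ) : A N := (A.g N .K ^ 2) ^ (N + 1) * uPlus N

/-- The universal invariant `K ^ (N+1) u₋` of the unknot with framing `-1`. -/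
def uTildeMinus (N : ℕ) : A N := (A.g N .K ^ 2) ^ (N + 1) * uMinus N

end

end SmallQuantum

/-!
Write `z = q^(1/2)`, a primitive `4N`-th root of unity. Moving the powers of `k` to the left factors
the `R`-matrix as `R = D Θ`, where `D = (4N)⁻¹ ∑ z^(-nj) k^n ⊗ k^j` and `Θ` is the truncated
`q`-exponential series in the nilpotent element `{1} e ⊗ f`. The inverse of `D` comes from the
orthogonality of the characters of `ℤ/4N` (`diag_mul_diag_neg`), and that of `Θ` from an alternating
identity for quantum factorials (`sum_qfact_inv`). So `R⁻¹` is explicit (`inverse_R`), and of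
the same shape as `R`.

After commuting the powers of `k` to the right, `u₊` and `u₋` are linear combinations of
`f^m e^m k^s` and of `e^m f^m k^s`, up to a constant shift of `s`, whose coefficients are explicit
scalars depending on `m` times Gauss sums `∑_n q^(±(n(s-n)/2 - mn))`. These vanish for odd `s` (`gauss_eq_zero_of_odd`), so only
powers of `K = k²` occur and both elements lie in `U N`.

The functional `φ^{SO(3)}` sees only the monomials `E^(N-1) F^(N-1) K^n` with `n` in one residue class
modulo `N`. Exchanging `E^m` and `F^m` changes an element only by terms of lower degree in `E`, so
that `u₊` and `u₋` can be treated alike: in both, only `m = N - 1` and two values of `s` contribute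
(`phiSO3_unknotSeries`). Completing the square writes the two Gauss sums as multiples of
`G = ∑_n q^(∓n²/2)`, with `|G|² = 8N`, and since `N` is odd their ratio is a square root of `-1`; so
their sum has modulus `4√N` (`norm_gauss_add_gauss`). The remaining factors are evaluated by
`∏_{k=1}^{N-1} |{k}| = N`, which holds as `{k}` is a unit times `1 - q^(2k)`, and the product is `1`.
-/

namespace SmallQuantum

noncomputable section

/-! ### Periodic sums and characters of `ℤ / 4 N` -/

/-- A sum over a full period does not change when the variable is shifted. -/
lemma sum_range_add_of_periodic {M : Type*} [AddCommMonoid M] {h : ℕ → M} {P : ℕ}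
    (hp : ∀ n, h (n + P) = h n) (c : ℕ) :
    ∑ n ∈ Finset.range P, h (n + c) = ∑ n ∈ Finset.range P, h n := by
  induction c with
  | zero => simp
  | succ c ih =>
    rw [← ih]
    rcases P with _ | P
    · simp
    · rw [Finset.sum_range_succ, Finset.sum_range_succ']
      congr 1
      · exact Finset.sum_congr rfl fun n _ => by congr 1; ring
      · rw [zero_add, ← hp c]; congr 1; ring

lemma sum_range_two_mul_of_odd {M : Type*} [AddCommMonoid M] {h : ℕ → M}
    (h0 : ∀ n, Odd n → h n = 0) (P : ℕ) :
    ∑ n ∈ Finset.range (2 * P), h n = ∑ n ∈ Finset.range P, h (2 * n) := by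
  induction P with
  | zero => simp
  | succ P ih =>
    rw [mul_add, mul_one, Finset.sum_range_succ, Finset.sum_range_succ, ih,
      h0 (2 * P + 1) ⟨P, rfl⟩, add_zero, Finset.sum_range_succ]

lemma qpow_eq_one_iff (N : ℕ) [NeZero N] (x : ℂ) :
    qpow N x = 1 ↔ ∃ t : ℤ, x = 2 * N * t := by
  have hN : (N : ℂ) ≠ 0 := by exact_mod_cast NeZero.ne N
  have hpi : (Real.pi : ℂ) ≠ 0 := by exact_mod_cast Real.pi_ne_zero
  rw [qpow, Complex.exp_eq_one_iff]
  refine exists_congr fun t => ?_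
  rw [div_eq_iff hN]
  constructor
  · intro h
    refine mul_left_cancel₀ (mul_ne_zero hpi Complex.I_ne_zero) ?_
    rw [h]; ring
  · rintro rfl; ring

/-- Exponents of `q` matter modulo `2 N` only. -/
lemma qpow_congr (N : ℕ) [NeZero N] {x y : ℂ} (t : ℤ) (h : x = y + 2 * N * t) :
    qpow N x = qpow N y := by
  rw [h, qpow_add, (qpow_eq_one_iff N (2 * N * t)).2 ⟨t, rfl⟩, mul_one]

lemma qpow_half_period (N : ℕ) [NeZero N] : qpow N N = -1 := by
  have hN : (N : ℂ) ≠ 0 := by exact_mod_cast NeZero.ne N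
  rw [qpow, mul_div_cancel_right₀ _ hN, Complex.exp_pi_mul_I]

lemma conj_qpow (N : ℕ) (x : ℝ) : (starRingEnd ℂ) (qpow N x) = qpow N (-x) := by
  rw [qpow, qpow, ← Complex.exp_conj]
  congr 1
  simp

lemma norm_qpow (N : ℕ) (x : ℝ) : ‖qpow N x‖ = 1 := by
  have : (Real.pi * Complex.I * x / N : ℂ) = ((Real.pi * x / N : ℝ) : ℂ) * Complex.I := by
    push_cast; ring
  rw [qpow, this, Complex.norm_exp_ofReal_mul_I]

/-- Orthogonality of the characters of `ℤ / 4 N`. -/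
lemma sum_qpow_half_mul (N : ℕ) [NeZero N] (x : ℤ) :
    ∑ j ∈ Finset.range (4 * N), qpow N (x * j / 2) = if (4 * N : ℤ) ∣ x then (4 * N : ℂ) else 0 := by
  have h : ∀ j : ℕ, qpow N (x * j / 2) = qpow N (x / 2) ^ j := by
    intro j; rw [← qpow_nat_mul]; congr 1; ring
  have hiff : qpow N (x / 2) = 1 ↔ (4 * N : ℤ) ∣ x := by
    rw [qpow_eq_one_iff]
    refine exists_congr fun t => ?_
    rw [div_eq_iff two_ne_zero]
    constructor
    · intro h
      have : (x : ℂ) = ((4 * N * t : ℤ) : ℂ) := by rw [h]; push_cast; ring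
      exact_mod_cast this
    · rintro rfl; push_cast; ring
  simp only [h]
  split_ifs with hd
  · simp [hiff.2 hd]
  · rw [geom_sum_eq (fun h1 => hd (hiff.1 h1)), ← qpow_nat_mul,
      (qpow_eq_one_iff N _).2 ⟨x, by push_cast; ring⟩]
    simp

/-! ### Quantum factorials -/

lemma qbrace_ne_zero {N : ℕ} [NeZero N] {k : ℕ} (h0 : 0 < k) (h : k < N) : qbrace N k ≠ 0 := by
  rw [qbrace, sub_ne_zero]
  intro he
  have h1 : qpow N (2 * k) = 1 := by
    calc qpow N (2 * k) = qpow N k * qpow N k := by rw [two_mul, qpow_add]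
      _ = qpow N (-k) * qpow N k := by rw [← he]
      _ = 1 := by rw [← qpow_add, neg_add_cancel, qpow_zero]
  obtain ⟨t, ht⟩ := (qpow_eq_one_iff N _).1 h1
  have h2 : (k : ℤ) = N * t := by
    have : (2 * k : ℂ) = 2 * (((N * t : ℤ)) : ℂ) := by rw [ht]; push_cast; ring
    exact_mod_cast mul_left_cancel₀ two_ne_zero this
  have h3 : (N : ℤ) ∣ k := ⟨t, h2⟩
  exact absurd (Nat.le_of_dvd h0 (by exact_mod_cast h3)) (by omega)

lemma qfact_ne_zero {N : ℕ} [NeZero N] (h1 : 1 < N) {m : ℕ} (h : m < N) : qfact N m ≠ 0 := by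
  rw [qfact, Finset.prod_ne_zero_iff]
  intro k hk
  rw [Finset.mem_Icc] at hk
  exact div_ne_zero (qbrace_ne_zero (by omega) (by omega))
    (by simpa using qbrace_ne_zero (k := 1) one_pos h1)

lemma qfact_zero (N : ℕ) : qfact N 0 = 1 := by simp [qfact]

lemma qfact_succ (N m : ℕ) : qfact N (m + 1) = qfact N m * qint N ((m + 1 : ℕ) : ℂ) := by
  rw [qfact, Finset.prod_Icc_succ_top (by omega), qfact]

lemma qint_add (N : ℕ) (x y : ℂ) :
    qint N (x + y) = qpow N x * qint N y + qpow N (-y) * qint N x := by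
  simp only [qint, qbrace]
  rw [neg_add, qpow_add, qpow_add]
  ring

/-- The identity which says that the truncated `q`-exponential series `∑ q^(m(m-1)/2) x^m / [m]!`
and `∑ (-1)^m q^(-m(m-1)/2) x^m / [m]!` are inverse to each other. After multiplication by
`[m] = q^(m-j) [j] + q^(-j) [m-j]` the sum telescopes. -/
lemma sum_qfact_inv {N : ℕ} [NeZero N] (h1 : 1 < N) {m : ℕ} (h0 : 0 < m) (h : m < N) :
    ∑ j ∈ Finset.range (m + 1), (-1) ^ j * qpow N (-(j * (m - 1)))
      * ((qfact N j)⁻¹ * (qfact N (m - j))⁻¹) = 0 := by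
  have hq : ∀ {j : ℕ}, 0 < j → j < N → qint N j ≠ 0 := fun hj hj' =>
    div_ne_zero (qbrace_ne_zero hj hj') (by simpa using qbrace_ne_zero (k := 1) one_pos h1)
  have hz : qint N 0 = 0 := by simp [qint, qbrace]
  refine (mul_eq_zero.1 (?_ : qint N m * _ = 0)).resolve_left (hq h0 h)
  rw [Finset.mul_sum]
  -- The contributions of the two summands of `[m] = q^(m-j) [j] + q^(-j) [m-j]`.
  let t1 : ℕ → ℂ := fun j => (-1) ^ j * qpow N (m - j * m)
      * (qint N j * (qfact N j)⁻¹ * (qfact N (m - j))⁻¹)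
  let t2 : ℕ → ℂ := fun j => (-1) ^ j * qpow N (-(j * m))
      * ((qfact N j)⁻¹ * (qint N ((m - j : ℕ) : ℂ) * (qfact N (m - j))⁻¹))
  have hs : ∀ j ∈ Finset.range (m + 1), qint N m * ((-1) ^ j * qpow N (-(j * (m - 1)))
      * ((qfact N j)⁻¹ * (qfact N (m - j))⁻¹)) = t1 j + t2 j := by
    intro j hj
    have hj' : j ≤ m := by simpa [Nat.lt_succ_iff] using hj
    have e : qint N m = qpow N (m - j) * qint N j + qpow N (-j) * qint N ((m - j : ℕ) : ℂ) := by
      rw [Nat.cast_sub hj', ← qint_add]; congr 1; ring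
    have e1 : qpow N (m - j * m) = qpow N (m - j) * qpow N (-(j * (m - 1))) := by
      rw [← qpow_add]; congr 1; ring
    have e2 : qpow N (-(j * m)) = qpow N (-j) * qpow N (-(j * (m - 1))) := by
      rw [← qpow_add]; congr 1; ring
    simp only [t1, t2]
    rw [e, e1, e2]
    ring
  rw [Finset.sum_congr rfl hs, Finset.sum_add_distrib, Finset.sum_range_succ',
    Finset.sum_range_succ t2]
  have h10 : t1 0 = 0 := by simp [t1, hz]
  have h2m : t2 m = 0 := by simp [t2, hz]
  rw [h10, h2m, add_zero, add_zero, ← Finset.sum_add_distrib]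
  refine Finset.sum_eq_zero fun j hj => ?_
  have hj' : j < m := by simpa using hj
  have f1 : qint N ((j + 1 : ℕ) : ℂ) * (qfact N (j + 1))⁻¹ = (qfact N j)⁻¹ := by
    have := hq (j := j + 1) (by omega) (by omega)
    rw [qfact_succ, mul_inv]; field_simp
  have f2 : qint N ((m - j : ℕ) : ℂ) * (qfact N (m - j))⁻¹ = (qfact N (m - (j + 1)))⁻¹ := by
    obtain ⟨l, hl⟩ : ∃ l, m - j = l + 1 := ⟨m - j - 1, by omega⟩
    have := hq (j := l + 1) (by omega) (by omega)
    rw [show m - (j + 1) = l by omega, hl, qfact_succ, mul_inv]; field_simp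
  simp only [t1, t2]
  rw [f1, f2, show (m - ((j + 1 : ℕ) : ℂ) * m : ℂ) = -(j * m) by push_cast; ring]
  ring

/-- `∏_{k=1}^{N-1} |{k}| = N`. -/
lemma norm_prod_qbrace (N : ℕ) [NeZero N] :
    ‖∏ k ∈ Finset.Icc 1 (N - 1), qbrace N k‖ = N := by
  obtain ⟨n, rfl⟩ : ∃ n, N = n + 1 := ⟨N - 1, (Nat.succ_pred_eq_of_ne_zero (NeZero.ne N)).symm⟩
  have hμ : IsPrimitiveRoot (qpow (n + 1) 2) (n + 1) := by
    have := Complex.isPrimitiveRoot_exp (n + 1) (by omega)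
    convert this using 1
    rw [qpow]; congr 1; ring
  have h1 := congrArg norm hμ.prod_one_sub_pow_eq_order
  rw [norm_prod] at *
  rw [Nat.add_sub_cancel, ← Finset.Ico_add_one_right_eq_Icc, Finset.prod_Ico_eq_prod_range,
    Nat.add_sub_cancel]
  have h2 : ‖(n + 1 : ℂ)‖ = ((n + 1 : ℕ) : ℝ) := by
    rw [← Complex.norm_natCast]; push_cast; rfl
  rw [← h2, ← h1]
  refine Finset.prod_congr rfl fun k _ => ?_
  have e : qbrace (n + 1) ((1 + k : ℕ) : ℂ)
      = -(qpow (n + 1) (-((k + 1 : ℕ) : ℝ) : ℝ) * (1 - qpow (n + 1) 2 ^ (k + 1))) := by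
    rw [qbrace, ← qpow_nat_mul, mul_sub, mul_one, ← qpow_add, neg_sub]
    push_cast
    congr 1 <;> congr 1 <;> ring
  rw [e, norm_neg, norm_mul, norm_qpow, one_mul]

/-! ### The two factors of the `R`-matrix and their inverses -/

section inverse

variable {B : Type*} [Ring B] [Algebra ℂ B]

lemma pow_mul_pow_of_mul {K x : B} {c : ℂ} (h : K * x = c • (x * K)) (n m : ℕ) :
    K ^ n * x ^ m = c ^ (n * m) • (x ^ m * K ^ n) := by
  induction n with
  | zero => simp
  | succ n ih =>
    rw [pow_succ, mul_assoc, mul_pow_of_mul h, mul_smul_comm, ← mul_assoc, ih, smul_mul_assoc,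
      smul_smul, mul_assoc, ← pow_add, add_mul, one_mul, add_comm m]

/-- The coefficient of `x ^ m`, `x = e ⊗ f`, in the `q`-exponential factor of `R` (`ε = 1`), and
in its inverse (`ε = -1`). -/
def thetaCoef (N : ℕ) (ε : ℤ) (m : ℕ) : ℂ :=
  (ε : ℂ) ^ m * (qbrace N 1 ^ m / qfact N m) * qpow N (ε * ((m : ℂ) * (m - 1) / 2))

/-- The truncated `q`-exponential series in `x` (`ε = 1`), and its inverse (`ε = -1`). -/
def theta (N : ℕ) (ε : ℤ) (x : B) : B := ∑ m ∈ Finset.range N, thetaCoef N ε m • x ^ m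

lemma theta_commute (N : ℕ) (ε ε' : ℤ) (x : B) : Commute (theta N ε x) (theta N ε' x) :=
  Commute.sum_left _ _ _ fun _ _ => Commute.sum_right _ _ _ fun _ _ =>
    ((Commute.pow_pow_self x _ _).smul_left _).smul_right _

lemma theta_neg_mul_theta (N : ℕ) [NeZero N] (h1 : 1 < N) {x : B} (hx : x ^ N = 0) :
    theta N (-1) x * theta N 1 x = 1 := by
  have hx' : ∀ j, N ≤ j → x ^ j = 0 := fun j hj => by
    rw [← Nat.sub_add_cancel hj, pow_add, hx, mul_zero]
  -- Terms of total degree at least `N` vanish, so the product is a sum over total degrees `m < N`.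
  let F : ℕ → ℕ → B := fun j i => (thetaCoef N (-1) j * thetaCoef N 1 i) • x ^ (j + i)
  have h2 : theta N (-1) x * theta N 1 x
      = ∑ j ∈ Finset.range N, ∑ i ∈ Finset.range (N - j), F j i := by
    rw [theta, theta, Finset.sum_mul_sum]
    refine Finset.sum_congr rfl fun j _ => ?_
    rw [← Finset.sum_subset (Finset.range_mono (Nat.sub_le N j))]
    · exact Finset.sum_congr rfl fun i _ => by simp only [F]; rw [smul_mul_smul_comm, pow_add]
    · intro i _ hi
      rw [smul_mul_smul_comm, ← pow_add, hx' _ (by simp at hi; omega), smul_zero]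
  rw [h2, ← Finset.sum_range_diag_flip, Finset.sum_eq_single 0]
  · simp [F, thetaCoef, qfact_zero, qpow_zero]
  · intro m hm hm0
    have hm' : m < N := by simpa using hm
    have hF : ∀ j ∈ Finset.range (m + 1), F j (m - j)
        = ((-1) ^ j * qpow N (-(j * (m - 1))) * ((qfact N j)⁻¹ * (qfact N (m - j))⁻¹))
          • ((qbrace N 1 ^ m * qpow N (m * (m - 1) / 2)) • x ^ m) := by
      intro j hj
      have hj' : j ≤ m := by simpa [Nat.lt_succ_iff] using hj
      have e : qpow N (-(j * (m - 1))) * qpow N (m * (m - 1) / 2)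
          = qpow N (-1 * ((j : ℂ) * (j - 1) / 2))
            * qpow N (1 * (((m - j : ℕ) : ℂ) * ((m - j : ℕ) - 1) / 2)) := by
        rw [← qpow_add, ← qpow_add, Nat.cast_sub hj']; congr 1; ring
      have e2 : qbrace N 1 ^ m = qbrace N 1 ^ j * qbrace N 1 ^ (m - j) := by
        rw [← pow_add, Nat.add_sub_cancel' hj']
      simp only [F]
      rw [Nat.add_sub_cancel' hj', smul_smul, thetaCoef, thetaCoef, e2]
      congr 1
      push_cast at e ⊢
      linear_combination (-((-1) ^ j * (qfact N j)⁻¹ * (qfact N (m - j))⁻¹ * qbrace N 1 ^ j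
        * qbrace N 1 ^ (m - j))) * e
    rw [Finset.sum_congr rfl hF, ← Finset.sum_smul, sum_qfact_inv h1 (by omega) hm', zero_smul]
  · intro h; simp [NeZero.ne N] at h

/-- The diagonal part of `R` (`ε = -1`), and its inverse (`ε = 1`), for commuting `a`, `b`. -/
def diag (N : ℕ) (ε : ℤ) (a b : B) : B :=
  (4 * N : ℂ)⁻¹ • ∑ n ∈ Finset.range (4 * N), ∑ j ∈ Finset.range (4 * N),
    qpow N (ε * ((n : ℂ) * j / 2)) • (a ^ n * b ^ j)

lemma diag_mul_diag_neg (N : ℕ) [NeZero N] (ε : ℤ) (hε : ε ^ 2 = 1) {a b : B} (hab : Commute a b)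
    (ha : a ^ (4 * N) = 1) (hb : b ^ (4 * N) = 1) : diag N ε a b * diag N (-ε) a b = 1 := by
  have hN : (N : ℂ) ≠ 0 := by exact_mod_cast NeZero.ne N
  have hP := NeZero.pos N
  have haP : ∀ n, a ^ (n + 4 * N) = a ^ n := fun n => by rw [pow_add, ha, mul_one]
  have hbP : ∀ n, b ^ (n + 4 * N) = b ^ n := fun n => by rw [pow_add, hb, mul_one]
  -- Substituting `s = n + n'`, `t = j + j'` modulo `4 N` makes the exponent linear in `n` and `j`.
  have hterm : ∀ n ∈ Finset.range (4 * N), ∀ j ∈ Finset.range (4 * N),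
      (qpow N (ε * ((n : ℂ) * j / 2)) • (a ^ n * b ^ j)) *
        (∑ n' ∈ Finset.range (4 * N), ∑ j' ∈ Finset.range (4 * N),
          qpow N ((-ε : ℤ) * ((n' : ℂ) * j' / 2)) • (a ^ n' * b ^ j'))
      = ∑ s ∈ Finset.range (4 * N), ∑ t ∈ Finset.range (4 * N),
        (qpow N (ε * (-((s : ℂ) * t) / 2)) * (qpow N ((ε * t : ℤ) * n / 2)
          * qpow N ((ε * s : ℤ) * j / 2))) • (a ^ s * b ^ t) := by
    intro n hn j hj
    have hn' : n ≤ 4 * N := (Finset.mem_range.1 hn).le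
    have hj' : j ≤ 4 * N := (Finset.mem_range.1 hj).le
    let H : ℕ → ℕ → B := fun n' j' =>
      qpow N (ε * (((n : ℂ) * j - n' * j') / 2)) • (a ^ (n + n') * b ^ (j + j'))
    have hH1 : ∀ n' j', H (n' + 4 * N) j' = H n' j' := by
      intro n' j'
      simp only [H]
      rw [← add_assoc, haP, qpow_congr N (-ε * j')]
      push_cast; ring
    have hH2 : ∀ n' j', H n' (j' + 4 * N) = H n' j' := by
      intro n' j'
      simp only [H]
      rw [← add_assoc j, hbP, qpow_congr N (-ε * n')]
      push_cast; ring
    calc _ = ∑ n' ∈ Finset.range (4 * N), ∑ j' ∈ Finset.range (4 * N), H n' j' := by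
          simp only [Finset.mul_sum, H]
          refine Finset.sum_congr rfl fun n' _ => Finset.sum_congr rfl fun j' _ => ?_
          rw [smul_mul_smul_comm, ← qpow_add, pow_add, pow_add, mul_assoc, ← mul_assoc (b ^ j),
            ← (hab.pow_pow n' j).eq, mul_assoc, mul_assoc]
          congr 2
          push_cast; ring
      _ = ∑ n' ∈ Finset.range (4 * N), ∑ j' ∈ Finset.range (4 * N),
            H (n' + (4 * N - n)) (j' + (4 * N - j)) := by
          rw [← sum_range_add_of_periodic (h := fun n' => ∑ j' ∈ Finset.range (4 * N), H n' j')
            (fun n' => by simp only [hH1]) (4 * N - n)]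
          refine Finset.sum_congr rfl fun n' _ => ?_
          rw [← sum_range_add_of_periodic (hH2 _) (4 * N - j)]
      _ = _ := by
          refine Finset.sum_congr rfl fun s _ => Finset.sum_congr rfl fun t _ => ?_
          simp only [H]
          rw [show n + (s + (4 * N - n)) = s + 4 * N by omega,
            show j + (t + (4 * N - j)) = t + 4 * N by omega, haP, hbP, ← qpow_add, ← qpow_add]
          rw [qpow_congr N (ε * (n + j - s - t - 4 * N))]
          push_cast [Nat.cast_sub hn', Nat.cast_sub hj']
          ring
  have hcomm : ∀ f : ℕ → ℕ → ℕ → B, ∑ n ∈ Finset.range (4 * N), ∑ s ∈ Finset.range (4 * N),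
      ∑ t ∈ Finset.range (4 * N), f n s t = ∑ s ∈ Finset.range (4 * N),
      ∑ t ∈ Finset.range (4 * N), ∑ n ∈ Finset.range (4 * N), f n s t := fun f => by
    rw [Finset.sum_comm]
    exact Finset.sum_congr rfl fun s _ => Finset.sum_comm
  have hdvd : ∀ t ∈ Finset.range (4 * N), ((4 * N : ℤ) ∣ ε * t ↔ t = 0) := by
    intro t ht
    have ht' : t < 4 * N := Finset.mem_range.1 ht
    constructor
    · intro h
      have h2 : (4 * N : ℤ) ∣ t := by
        have := h.mul_left ε
        rwa [← mul_assoc, ← pow_two, hε, one_mul] at this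
      exact Nat.eq_zero_of_dvd_of_lt (by exact_mod_cast h2) ht'
    · rintro rfl; simp
  have h0 : 0 ∈ Finset.range (4 * N) := Finset.mem_range.2 (by omega)
  rw [diag, diag, smul_mul_smul_comm, Finset.sum_mul]
  simp only [Finset.sum_mul _ _ (∑ n' ∈ Finset.range (4 * N), _)]
  rw [Finset.sum_congr rfl fun n hn => Finset.sum_congr rfl fun j hj => hterm n hn j hj]
  rw [(Finset.sum_congr rfl fun n _ => hcomm _).trans (hcomm _)]
  rw [Finset.sum_eq_single_of_mem 0 h0, Finset.sum_eq_single_of_mem 0 h0]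
  · simp only [← Finset.sum_smul, ← Finset.mul_sum, ← Finset.sum_mul]
    rw [sum_qpow_half_mul, if_pos (by simp), smul_smul]
    simp only [Nat.cast_zero, mul_zero, neg_zero, zero_div, qpow_zero, pow_zero, one_mul]
    field_simp
    simp
  · intro t ht ht0
    simp only [← Finset.sum_smul, ← Finset.mul_sum, ← Finset.sum_mul]
    rw [sum_qpow_half_mul, if_neg (by rwa [hdvd t ht]), zero_mul, mul_zero, zero_smul]
  · intro s hs hs0
    refine Finset.sum_eq_zero fun t _ => ?_
    simp only [← Finset.sum_smul, ← Finset.mul_sum, ← Finset.sum_mul]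
    rw [sum_qpow_half_mul N (ε * s), if_neg (by rwa [hdvd s hs]), mul_zero, mul_zero, zero_smul]

lemma diag_commute (N : ℕ) (ε ε' : ℤ) {a b : B} (hab : Commute a b) :
    Commute (diag N ε a b) (diag N ε' a b) := by
  have h : ∀ n j n' j' : ℕ, Commute (a ^ n * b ^ j) (a ^ n' * b ^ j') := fun n j n' j' =>
    ((Commute.pow_pow_self a n n').mul_right (hab.pow_pow n j')).mul_left
      ((hab.symm.pow_pow j n').mul_right (Commute.pow_pow_self b j j'))
  refine Commute.smul_left (Commute.smul_right ?_ _) _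
  exact Commute.sum_left _ _ _ fun _ _ => Commute.sum_left _ _ _ fun _ _ =>
    Commute.sum_right _ _ _ fun _ _ => Commute.sum_right _ _ _ fun _ _ =>
    ((h _ _ _ _).smul_left _).smul_right _

end inverse

/-! ### The inverse of the `R`-matrix -/

lemma A.K_pow_mul_E_pow (N n m : ℕ) :
    A.g N .K ^ n * A.g N .E ^ m = qpow N (n * m) • (A.g N .E ^ m * A.g N .K ^ n) := by
  rw [pow_mul_pow_of_mul (mul_of_conj (A.Kinv_K N) (A.K_E N)), ← qpow_nat_mul]
  push_cast
  rw [mul_one]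

lemma A.K_pow_mul_F_pow (N n m : ℕ) :
    A.g N .K ^ n * A.g N .F ^ m = qpow N (-(n * m)) • (A.g N .F ^ m * A.g N .K ^ n) := by
  rw [pow_mul_pow_of_mul (mul_of_conj (A.Kinv_K N) (A.K_F N)), ← qpow_nat_mul]
  push_cast
  rw [mul_neg_one]

/-- The inverse of the `R`-matrix, in the same form as `R`. -/
def Rinv (N : ℕ) : A N ⊗[ℂ] A N :=
  (4 * N : ℂ)⁻¹ • ∑ m ∈ Finset.range N, ∑ n ∈ Finset.range (4 * N), ∑ j ∈ Finset.range (4 * N),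
    (thetaCoef N (-1) m * qpow N ((n : ℂ) * j / 2)) •
      ((A.g N .E ^ m * A.g N .K ^ n) ⊗ₜ[ℂ] (A.g N .F ^ m * A.g N .K ^ j))

lemma R_eq_diag_mul_theta (N : ℕ) :
    R N = diag N (-1) (A.g N .K ⊗ₜ[ℂ] (1 : A N)) ((1 : A N) ⊗ₜ[ℂ] A.g N .K)
      * theta N 1 (A.g N .E ⊗ₜ[ℂ] A.g N .F) := by
  rw [R, diag, theta, smul_mul_assoc, Finset.mul_sum]
  congr 1
  refine Finset.sum_congr rfl fun m _ => ?_
  rw [Finset.sum_mul]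
  refine Finset.sum_congr rfl fun n _ => ?_
  rw [Finset.sum_mul]
  refine Finset.sum_congr rfl fun j _ => ?_
  rw [smul_mul_smul_comm, Algebra.TensorProduct.tmul_pow, Algebra.TensorProduct.tmul_pow,
    Algebra.TensorProduct.tmul_pow, one_pow, one_pow, Algebra.TensorProduct.tmul_mul_tmul,
    Algebra.TensorProduct.tmul_mul_tmul, one_mul, mul_one, A.K_pow_mul_E_pow,
    A.K_pow_mul_F_pow, TensorProduct.smul_tmul_smul, smul_smul]
  congr 1
  rw [thetaCoef, Int.cast_one, one_pow, one_mul]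
  calc _ = qbrace N 1 ^ m / qfact N m * (qpow N (((-1 : ℤ) : ℂ) * (n * j / 2)) *
        qpow N (1 * ((m : ℂ) * (m - 1) / 2)) * (qpow N (n * m) * qpow N (-(j * m)))) := by
        rw [← qpow_add, ← qpow_add, ← qpow_add]
        congr 2
        push_cast; ring
    _ = _ := by ring

lemma Rinv_eq_theta_mul_diag (N : ℕ) :
    Rinv N = theta N (-1) (A.g N .E ⊗ₜ[ℂ] A.g N .F)
      * diag N 1 (A.g N .K ⊗ₜ[ℂ] (1 : A N)) ((1 : A N) ⊗ₜ[ℂ] A.g N .K) := by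
  rw [Rinv, diag, theta, mul_smul_comm, Finset.sum_mul]
  congr 1
  refine Finset.sum_congr rfl fun m _ => ?_
  rw [Finset.mul_sum]
  refine Finset.sum_congr rfl fun n _ => ?_
  rw [Finset.mul_sum]
  refine Finset.sum_congr rfl fun j _ => ?_
  rw [smul_mul_smul_comm, Algebra.TensorProduct.tmul_pow, Algebra.TensorProduct.tmul_pow,
    Algebra.TensorProduct.tmul_pow, one_pow, one_pow, Algebra.TensorProduct.tmul_mul_tmul,
    Algebra.TensorProduct.tmul_mul_tmul, one_mul, mul_one, Int.cast_one, one_mul]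

lemma inverse_R (N : ℕ) [NeZero N] (h1 : 1 < N) : Ring.inverse (R N) = Rinv N := by
  have hx : (A.g N .E ⊗ₜ[ℂ] A.g N .F) ^ N = 0 := by
    rw [Algebra.TensorProduct.tmul_pow, A.E_pow, TensorProduct.zero_tmul]
  have hab : Commute (A.g N .K ⊗ₜ[ℂ] (1 : A N)) ((1 : A N) ⊗ₜ[ℂ] A.g N .K) := by
    rw [Commute, SemiconjBy, Algebra.TensorProduct.tmul_mul_tmul,
      Algebra.TensorProduct.tmul_mul_tmul, one_mul, mul_one]
  have ha : (A.g N .K ⊗ₜ[ℂ] (1 : A N)) ^ (4 * N) = 1 := by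
    rw [Algebra.TensorProduct.tmul_pow, A.K_pow, one_pow, Algebra.TensorProduct.one_def]
  have hb : ((1 : A N) ⊗ₜ[ℂ] A.g N .K) ^ (4 * N) = 1 := by
    rw [Algebra.TensorProduct.tmul_pow, A.K_pow, one_pow, Algebra.TensorProduct.one_def]
  have hθ := theta_neg_mul_theta (B := A N ⊗[ℂ] A N) N h1 hx
  have hθ' := hθ
  rw [(theta_commute N (-1) 1 _).eq] at hθ'
  have hd := diag_mul_diag_neg (B := A N ⊗[ℂ] A N) N (-1) (by norm_num) hab ha hb
  rw [neg_neg] at hd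
  have hd' := hd
  rw [(diag_commute N (-1) 1 hab).eq] at hd'
  have e1 : R N * Rinv N = 1 := by
    rw [R_eq_diag_mul_theta, Rinv_eq_theta_mul_diag, mul_assoc, ← mul_assoc (theta N 1 _), hθ',
      one_mul, hd]
  have e2 : Rinv N * R N = 1 := by
    rw [R_eq_diag_mul_theta, Rinv_eq_theta_mul_diag, mul_assoc, ← mul_assoc (diag N 1 _ _), hd',
      one_mul, hθ]
  exact Ring.inverse_unit ⟨R N, Rinv N, e1, e2⟩

/-! ### The unknot invariants inside `U N` -/

/-- The Gauss sum which arises as the coefficient of `k ^ s`, up to a shift of the exponent, in the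
terms of `u₊` (`ε = -1`) and `u₋` (`ε = 1`) which have degree `m` in both `e` and `f`. -/
def gauss (N : ℕ) (ε : ℤ) (m s : ℕ) : ℂ :=
  ∑ n ∈ Finset.range (4 * N), qpow N (ε * ((n : ℂ) * (s - n) / 2 - m * n))

/-- The shift of the summation variable by `2 N` multiplies the sum by `(-1) ^ s`; hence only even
powers of `k` occur in `u₊` and `u₋`. -/
lemma gauss_eq_zero_of_odd (N : ℕ) [NeZero N] {ε : ℤ} (hε : Odd ε) (m : ℕ) {s : ℕ} (hs : Odd s) :
    gauss N ε m s = 0 := by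
  have hp : ∀ n : ℕ, qpow N (ε * (((n + 4 * N : ℕ) : ℂ) * (s - ((n + 4 * N : ℕ) : ℂ)) / 2
      - m * ((n + 4 * N : ℕ) : ℂ))) = qpow N (ε * ((n : ℂ) * (s - n) / 2 - m * n)) := by
    intro n
    refine qpow_congr N (ε * (s - 2 * n - 4 * N - 2 * m)) ?_
    push_cast; ring
  have h := sum_range_add_of_periodic
    (h := fun n : ℕ => qpow N (ε * ((n : ℂ) * (s - n) / 2 - m * n))) hp (2 * N)
  obtain ⟨a, rfl⟩ := hε
  obtain ⟨b, rfl⟩ := hs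
  have h2 : ∀ n : ℕ, qpow N (((2 * a + 1 : ℤ) : ℂ) * (((n + 2 * N : ℕ) : ℂ)
      * (((2 * b + 1 : ℕ) : ℂ) - ((n + 2 * N : ℕ) : ℂ)) / 2 - m * ((n + 2 * N : ℕ) : ℂ)))
      = -qpow N (((2 * a + 1 : ℤ) : ℂ) * ((n : ℂ) * (((2 * b + 1 : ℕ) : ℂ) - n) / 2 - m * n)) := by
    intro n
    rw [← neg_one_mul, ← qpow_half_period N, ← qpow_add]
    refine qpow_congr N (a * (2 * b + 1) + b - (2 * a + 1) * (n + N + m)) ?_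
    push_cast; ring
  simp only [h2] at h
  rw [Finset.sum_neg_distrib] at h
  rw [gauss]
  exact self_eq_neg.1 h.symm

lemma A.K_pow_add_period (N n : ℕ) : A.g N .K ^ (n + 4 * N) = A.g N .K ^ n := by
  rw [pow_add, A.K_pow, mul_one]

lemma A.Kinv_sq_pow (N : ℕ) [NeZero N] : (A.g N .Kinv ^ 2) ^ (N - 1) = A.g N .K ^ (2 * N + 2) := by
  have hP := NeZero.pos N
  have hc : Commute (A.g N .Kinv) (A.g N .K) := by
    rw [Commute, SemiconjBy, A.K_Kinv, A.Kinv_K]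
  have h1 : A.g N .Kinv ^ (2 * (N - 1)) * A.g N .K ^ (2 * (N - 1)) = 1 := by
    rw [← hc.mul_pow, A.Kinv_K, one_pow]
  rw [← pow_mul]
  calc _ = A.g N .Kinv ^ (2 * (N - 1)) * A.g N .K ^ (4 * N) := by rw [A.K_pow, mul_one]
    _ = A.g N .Kinv ^ (2 * (N - 1)) * A.g N .K ^ (2 * (N - 1) + (2 * N + 2)) := by
      congr 2; omega
    _ = _ := by rw [pow_add, ← mul_assoc, h1, one_mul]

/-- Collect the powers of `k` in a double sum. -/
lemma A.sum_qpow_smul_mul_K_pow (N : ℕ) [NeZero N] {ε : ℤ} (hε : Odd ε) (m c : ℕ) (X : A N) :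
    ∑ n ∈ Finset.range (4 * N), ∑ j ∈ Finset.range (4 * N),
      qpow N (ε * ((n : ℂ) * j / 2 - m * n)) • (X * A.g N .K ^ (n + j + c))
    = ∑ r ∈ Finset.range (2 * N), gauss N ε m (2 * r) • (X * A.g N .K ^ (2 * r + c)) := by
  have h1 : ∀ n ∈ Finset.range (4 * N), ∑ j ∈ Finset.range (4 * N),
      qpow N (ε * ((n : ℂ) * j / 2 - m * n)) • (X * A.g N .K ^ (n + j + c))
      = ∑ s ∈ Finset.range (4 * N),
        qpow N (ε * ((n : ℂ) * (s - n) / 2 - m * n)) • (X * A.g N .K ^ (s + c)) := by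
    intro n hn
    have hn' : n ≤ 4 * N := (Finset.mem_range.1 hn).le
    rw [← sum_range_add_of_periodic (P := 4 * N) _ (4 * N - n)]
    · refine Finset.sum_congr rfl fun s _ => ?_
      rw [show n + (s + (4 * N - n)) + c = s + c + 4 * N by omega, A.K_pow_add_period]
      congr 1
      refine qpow_congr N (ε * n) ?_
      push_cast [Nat.cast_sub hn']; ring
    · intro j
      rw [show n + (j + 4 * N) + c = n + j + c + 4 * N by omega, A.K_pow_add_period]
      congr 1
      refine qpow_congr N (ε * n) ?_
      push_cast; ring
  rw [Finset.sum_congr rfl h1, Finset.sum_comm]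
  simp only [← Finset.sum_smul]
  change ∑ s ∈ Finset.range (4 * N), gauss N ε m s • (X * A.g N .K ^ (s + c)) = _
  rw [show 4 * N = 2 * (2 * N) by ring, sum_range_two_mul_of_odd]
  intro s hs
  rw [gauss_eq_zero_of_odd N hε m hs, zero_smul]

/-- The form which `u₊` (`δ = 1`, `X m = F ^ m E ^ m`) and `u₋` (`δ = -1`, `X m = E ^ m F ^ m`)
take as elements of `U N`. -/
def unknotSeries (N : ℕ) (δ : ℤ) (X : ℕ → U N) : U N :=
  (4 * N : ℂ)⁻¹ • ∑ m ∈ Finset.range N, (thetaCoef N δ m * qpow N (δ * ((2 * N + 2) * m))) •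
    ∑ r ∈ Finset.range (2 * N), gauss N (-δ) m (2 * r) • (X m * U.g N .K ^ (r + N + 1))

lemma incl_unknotSeries (N : ℕ) [NeZero N] {δ : ℤ} (hδ : Odd δ) (X : ℕ → U N) :
    incl N (unknotSeries N δ X) = (4 * N : ℂ)⁻¹ • ∑ m ∈ Finset.range N,
      (thetaCoef N δ m * qpow N (δ * ((2 * N + 2) * m))) •
      ∑ n ∈ Finset.range (4 * N), ∑ j ∈ Finset.range (4 * N),
        qpow N ((-δ : ℤ) * ((n : ℂ) * j / 2 - m * n)) •
          (incl N (X m) * A.g N .K ^ (n + j + (2 * N + 2))) := by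
  rw [unknotSeries, map_smul, map_sum]
  congr 1
  refine Finset.sum_congr rfl fun m _ => ?_
  rw [map_smul, map_sum, A.sum_qpow_smul_mul_K_pow N hδ.neg]
  congr 1
  refine Finset.sum_congr rfl fun r _ => ?_
  rw [map_smul, map_mul, map_pow, incl_g, inclGen, ← pow_mul]
  congr 3
  ring

lemma incl_unknotSeries_eq_uMinus (N : ℕ) [NeZero N] (h1 : 1 < N) :
    incl N (unknotSeries N (-1) fun m => U.g N .E ^ m * U.g N .F ^ m) = uMinus N := by
  rw [incl_unknotSeries N (by decide), uMinus, inverse_R N h1, Rinv, map_smul, map_smul, map_sum,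
    map_sum]
  congr 1
  refine Finset.sum_congr rfl fun m _ => ?_
  rw [map_sum, map_sum, Finset.smul_sum]
  refine Finset.sum_congr rfl fun n _ => ?_
  rw [map_sum, map_sum, Finset.smul_sum]
  refine Finset.sum_congr rfl fun j _ => ?_
  rw [map_smul, map_smul, TensorProduct.comm_tmul, tangleInv_tmul, A.Kinv_sq_pow, map_mul, map_pow,
    map_pow, incl_g, incl_g, inclGen, inclGen, smul_smul]
  have e : A.g N .E ^ m * A.g N .K ^ n * A.g N .K ^ (2 * N + 2) * (A.g N .F ^ m * A.g N .K ^ j)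
      = qpow N (-(((n + (2 * N + 2) : ℕ) : ℂ) * m)) •
        (A.g N .E ^ m * A.g N .F ^ m * A.g N .K ^ (n + j + (2 * N + 2))) := by
    rw [mul_assoc (A.g N .E ^ m), ← pow_add, mul_assoc (A.g N .E ^ m), ← mul_assoc (A.g N .K ^ _),
      A.K_pow_mul_F_pow, smul_mul_assoc, mul_smul_comm, mul_assoc, ← pow_add, ← mul_assoc]
    congr 3
    omega
  rw [e, smul_smul]
  congr 1
  rw [mul_assoc, mul_assoc, ← qpow_add, ← qpow_add]
  congr 2
  push_cast; ring

lemma incl_unknotSeries_eq_uPlus (N : ℕ) [NeZero N] :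
    incl N (unknotSeries N 1 fun m => U.g N .F ^ m * U.g N .E ^ m) = uPlus N := by
  rw [incl_unknotSeries N (by decide), uPlus, R, map_smul, map_sum]
  congr 1
  refine Finset.sum_congr rfl fun m _ => ?_
  rw [map_sum, Finset.smul_sum]
  refine Finset.sum_congr rfl fun n _ => ?_
  rw [map_sum, Finset.smul_sum]
  refine Finset.sum_congr rfl fun j _ => ?_
  rw [map_smul, tangleInv_tmul, A.Kinv_sq_pow, map_mul, map_pow,
    map_pow, incl_g, incl_g, inclGen, inclGen, smul_smul]
  have e : A.g N .F ^ m * A.g N .K ^ j * A.g N .K ^ (2 * N + 2) * (A.g N .E ^ m * A.g N .K ^ n)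
      = qpow N (((j + (2 * N + 2) : ℕ) : ℂ) * m) •
        (A.g N .F ^ m * A.g N .E ^ m * A.g N .K ^ (n + j + (2 * N + 2))) := by
    rw [mul_assoc (A.g N .F ^ m), ← pow_add, mul_assoc (A.g N .F ^ m), ← mul_assoc (A.g N .K ^ _),
      A.K_pow_mul_E_pow, smul_mul_assoc, mul_smul_comm, mul_assoc, ← pow_add, ← mul_assoc]
    congr 3
    omega
  rw [e, smul_smul, thetaCoef, Int.cast_one, one_pow, one_mul]
  congr 1
  rw [mul_assoc, mul_assoc, mul_assoc, ← qpow_add, ← qpow_add, ← qpow_add]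
  congr 2
  push_cast; ring

/-! ### The values of `φ^{SO(3)}` -/

/-- The span of the monomials `E ^ i F ^ j K ^ l` with `i < b`. -/
def lowE (N b : ℕ) : Submodule ℂ (U N) :=
  Submodule.span ℂ {x | ∃ i j l : ℕ, i < b ∧ x = U.g N .E ^ i * U.g N .F ^ j * U.g N .K ^ l}

lemma mono_mem_lowE {N b i : ℕ} (h : i < b) (j l : ℕ) :
    U.g N .E ^ i * U.g N .F ^ j * U.g N .K ^ l ∈ lowE N b :=
  Submodule.subset_span ⟨i, j, l, h, rfl⟩

lemma lowE_mul_K_pow {N b : ℕ} {x : U N} (hx : x ∈ lowE N b) (n : ℕ) :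
    x * U.g N .K ^ n ∈ lowE N b := by
  induction hx using Submodule.span_induction with
  | mem x hx =>
    obtain ⟨i, j, l, h, rfl⟩ := hx
    rw [mul_assoc _ (U.g N .K ^ l), ← pow_add]
    exact mono_mem_lowE h _ _
  | zero => simp
  | add x y _ _ hx hy => rw [add_mul]; exact add_mem hx hy
  | smul c x _ hx => rw [smul_mul_assoc]; exact Submodule.smul_mem _ _ hx

lemma U.K_pow_mul_F_pow (N n m : ℕ) :
    U.g N .K ^ n * U.g N .F ^ m = qpow N (-2) ^ (n * m) • (U.g N .F ^ m * U.g N .K ^ n) :=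
  pow_mul_pow_of_mul (U.K_mul_F N) n m

/-- The commutator of `F` with a monomial has smaller degree in `E`. -/
lemma F_mul_mono_sub_mem_lowE (N : ℕ) [NeZero N] (b j l : ℕ) :
    U.g N .F * (U.g N .E ^ b * U.g N .F ^ j * U.g N .K ^ l)
      - U.g N .E ^ b * U.g N .F ^ (j + 1) * U.g N .K ^ l ∈ lowE N b := by
  rcases b with _ | b
  · simp [← mul_assoc, ← pow_succ']
  · have hs := straighten (U.K_mul_E N) (inv_mul_of_mul (qpow_ne_zero N 2) (U.Kinv_K N)
      (U.K_Kinv N) (U.K_mul_E N)) (U.E_F N) b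
    have hK : ∀ n, U.g N .E ^ b * U.g N .K ^ n * (U.g N .F ^ j * U.g N .K ^ l)
        ∈ lowE N (b + 1) := by
      intro n
      rw [mul_assoc, ← mul_assoc (U.g N .K ^ n), U.K_pow_mul_F_pow, smul_mul_assoc, mul_smul_comm,
        mul_assoc, ← pow_add, ← mul_assoc]
      exact Submodule.smul_mem _ _ (mono_mem_lowE (by omega) _ _)
    have hK1 := hK 1
    rw [pow_one] at hK1
    have hK2 := hK (2 * N - 1)
    rw [← U.Kinv_eq] at hK2
    rw [mul_assoc (U.g N .E ^ (b + 1)) (U.g N .F ^ j), ← mul_assoc (U.g N .F), hs, add_mul,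
      sub_mul, smul_mul_assoc, smul_mul_assoc, pow_succ' (U.g N .F) j]
    have e : U.g N .E ^ (b + 1) * U.g N .F * (U.g N .F ^ j * U.g N .K ^ l)
        = U.g N .E ^ (b + 1) * (U.g N .F * U.g N .F ^ j) * U.g N .K ^ l := by
      simp only [mul_assoc]
    rw [e, add_sub_right_comm, sub_sub_cancel_left]
    exact add_mem (neg_mem (Submodule.smul_mem _ _ hK1)) (Submodule.smul_mem _ _ hK2)

lemma lowE_mono {N b c : ℕ} (h : b ≤ c) : lowE N b ≤ lowE N c :=
  Submodule.span_mono fun _ ⟨i, j, l, hi, hx⟩ => ⟨i, j, l, hi.trans_le h, hx⟩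

lemma F_mul_mem_lowE {N b : ℕ} [NeZero N] {x : U N} (hx : x ∈ lowE N b) :
    U.g N .F * x ∈ lowE N b := by
  induction hx using Submodule.span_induction with
  | mem x hx =>
    obtain ⟨i, j, l, h, rfl⟩ := hx
    have h1 := lowE_mono h.le (F_mul_mono_sub_mem_lowE N i j l)
    have h2 := add_mem h1 (mono_mem_lowE h (j + 1) l)
    rwa [sub_add_cancel] at h2
  | zero => simp
  | add x y _ _ hx hy => rw [mul_add]; exact add_mem hx hy
  | smul c x _ hx => rw [mul_smul_comm]; exact Submodule.smul_mem _ _ hx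

lemma F_pow_mul_E_pow_sub_mem_lowE (N : ℕ) [NeZero N] (a b : ℕ) :
    U.g N .F ^ a * U.g N .E ^ b - U.g N .E ^ b * U.g N .F ^ a ∈ lowE N b := by
  induction a with
  | zero => simp
  | succ a ih =>
    have h1 := F_mul_mem_lowE ih
    have h2 := F_mul_mono_sub_mem_lowE N b a 0
    rw [pow_zero, mul_one, mul_one] at h2
    have h3 := add_mem h1 h2
    rwa [mul_sub, sub_add_sub_cancel, ← mul_assoc, ← pow_succ'] at h3

lemma mu_mono_of_lt (N : ℕ) [NeZero N] {i m : ℕ} (hi : i < N) (hm : m < N) (n : ℕ) :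
    mu N (U.g N .E ^ i * U.g N .F ^ m * U.g N .K ^ n)
      = if i = N - 1 ∧ m = N - 1 ∧ n % (2 * N) = N + 1 then zeta N else 0 := by
  have hP := NeZero.pos N
  have h := mu_mono N ⟨i, hi⟩ ⟨m, hm⟩ ⟨n % (2 * N), Nat.mod_lt _ (by omega)⟩
  have hK : U.g N .K ^ n = U.g N .K ^ (n % (2 * N)) := by
    conv_lhs => rw [← Nat.mod_add_div n (2 * N), pow_add, pow_mul, U.K_pow, one_pow, mul_one]
  rw [hK]
  exact h

/-- The factor `(K ^ N + 1) / 2` makes the integral depend on the power of `K` modulo `N` only. -/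
lemma mu_mono_mul_halfIdem (N : ℕ) [NeZero N] (h1 : 1 < N) {i m : ℕ} (hi : i < N) (hm : m < N)
    (n : ℕ) : mu N (U.g N .E ^ i * U.g N .F ^ m * U.g N .K ^ n * halfIdem N)
      = if i = N - 1 ∧ m = N - 1 ∧ n % N = 1 then zeta N / 2 else 0 := by
  rw [halfIdem, mul_smul_comm, mul_add, mul_one, mul_assoc _ (U.g N .K ^ n), ← pow_add, map_smul,
    map_add, mu_mono_of_lt N hi hm, mu_mono_of_lt N hi hm, smul_eq_mul]
  by_cases h : i = N - 1 ∧ m = N - 1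
  · have hlt : n % (2 * N) < 2 * N := Nat.mod_lt _ (by omega)
    have hmod : n % N = n % (2 * N) % N := (Nat.mod_mod_of_dvd n ⟨2, by ring⟩).symm
    have hadd : (n + N) % (2 * N) = (n % (2 * N) + N) % (2 * N) := by
      rw [Nat.mod_add_mod]
    rw [hmod, hadd]
    generalize n % (2 * N) = t at hlt
    rcases lt_or_ge t N with ht | ht
    · rw [Nat.mod_eq_of_lt (show t + N < 2 * N by omega), Nat.mod_eq_of_lt ht]
      by_cases h2 : t = 1
      · rw [if_pos ⟨h.1, h.2, by omega⟩, if_neg (by omega), if_pos ⟨h.1, h.2, h2⟩]; ring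
      · rw [if_neg (by omega), if_neg (by omega), if_neg (by omega)]; ring
    · have e1 : (t + N) % (2 * N) = t - N := by
        rw [Nat.mod_eq_sub_mod (by omega), Nat.mod_eq_of_lt (by omega)]; omega
      have e2 : t % N = t - N := by
        rw [Nat.mod_eq_sub_mod (by omega), Nat.mod_eq_of_lt (by omega)]
      rw [e1, e2]
      by_cases h2 : t = N + 1
      · rw [if_neg (by omega), if_pos ⟨h.1, h.2, h2⟩, if_pos ⟨h.1, h.2, by omega⟩]; ring
      · rw [if_neg (by omega), if_neg (by omega), if_neg (by omega)]; ring
  · rw [if_neg (by tauto), if_neg (by tauto), if_neg (by tauto)]; simp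

lemma mu_mul_halfIdem_of_mem_lowE {N : ℕ} [NeZero N] (h1 : 1 < N) {x : U N}
    (hx : x ∈ lowE N (N - 1)) : mu N (x * halfIdem N) = 0 := by
  induction hx using Submodule.span_induction with
  | mem x hx =>
    obtain ⟨i, j, l, h, rfl⟩ := hx
    by_cases hj : j < N
    · rw [mu_mono_mul_halfIdem N h1 (by omega) hj, if_neg (by omega)]
    · rw [← Nat.sub_add_cancel (not_lt.1 hj), pow_add (U.g N .F), U.F_pow]
      simp
  | zero => simp
  | add x y _ _ hx hy => rw [add_mul, map_add, hx, hy, add_zero]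
  | smul c x _ hx => rw [smul_mul_assoc, map_smul, hx, smul_zero]

/-- Only the top degree part contributes to the integral, and there the order of `E` and `F` does
not matter. -/
lemma mu_mul_K_pow_mul_halfIdem {N : ℕ} [NeZero N] (h1 : 1 < N) {m : ℕ} (hm : m < N) {Y : U N}
    (hY : Y - U.g N .E ^ m * U.g N .F ^ m ∈ lowE N m) (n : ℕ) :
    mu N (Y * U.g N .K ^ n * halfIdem N) = if m = N - 1 ∧ n % N = 1 then zeta N / 2 else 0 := by
  have h := mu_mul_halfIdem_of_mem_lowE h1
    (lowE_mono (by omega : m ≤ N - 1) (lowE_mul_K_pow hY n))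
  rw [sub_mul, sub_mul, map_sub, sub_eq_zero, mu_mono_mul_halfIdem N h1 hm hm] at h
  rw [h]
  congr 1
  simp

lemma phiSO3_unknotSeries (N : ℕ) [NeZero N] (h1 : 1 < N) (δ : ℤ) (X : ℕ → U N)
    (hK : ∀ m, Commute (U.g N .K) (X m))
    (hX : ∀ m, X m - U.g N .E ^ m * U.g N .F ^ m ∈ lowE N m) :
    phiSO3 N (pr N (U.g N .K ^ (N + 1) * unknotSeries N δ X))
      = Real.sqrt 2 * ((4 * N : ℂ)⁻¹ * (thetaCoef N δ (N - 1)
          * qpow N (δ * ((2 * N + 2) * (N - 1 : ℕ)))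
        * ((gauss N (-δ) (N - 1) (2 * (N - 2)) + gauss N (-δ) (N - 1) (2 * (2 * N - 2)))
          * (zeta N / 2)))) := by
  -- The factors `K ^ (N+1)` come from `φ`, from the passage `u ↦ K ^ (N+1) u`, and from
  -- `K ^ (1-N) = K ^ (N+1)`.
  have e : ∀ m r : ℕ, U.g N .K ^ (N + 1) * (U.g N .K ^ (N + 1) *
      (X m * U.g N .K ^ (r + N + 1)) * halfIdem N)
      = X m * U.g N .K ^ (r + 3 * N + 3) * halfIdem N := by
    intro m r
    rw [← mul_assoc, ← mul_assoc, ← mul_assoc, ← pow_add, ((hK m).pow_left _).eq, mul_assoc (X m),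
      ← pow_add]
    congr 3
    ring
  change Real.sqrt 2 * mu N (U.g N .K ^ (N + 1) *
    (U.g N .K ^ (N + 1) * unknotSeries N δ X * halfIdem N)) = _
  congr 1
  simp only [unknotSeries, mul_smul_comm, smul_mul_assoc, Finset.mul_sum, Finset.sum_mul, e,
    map_smul, map_sum, smul_eq_mul]
  simp only [← Finset.mul_sum]
  congr 1
  rw [Finset.sum_eq_single_of_mem (N - 1) (Finset.mem_range.2 (by omega))]
  · congr 1
    have hr : ∀ r ∈ Finset.range (2 * N), gauss N (-δ) (N - 1) (2 * r) *
        mu N (X (N - 1) * U.g N .K ^ (r + 3 * N + 3) * halfIdem N)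
        = (if r = N - 2 then gauss N (-δ) (N - 1) (2 * r) * (zeta N / 2) else 0)
          + (if r = 2 * N - 2 then gauss N (-δ) (N - 1) (2 * r) * (zeta N / 2) else 0) := by
      intro r hr
      have hr' : r < 2 * N := Finset.mem_range.1 hr
      rw [mu_mul_K_pow_mul_halfIdem h1 (by omega) (hX _)]
      have hm : (r + 3 * N + 3) % N = (r + 3) % N := by
        rw [show r + 3 * N + 3 = r + 3 + N * 3 by ring, Nat.add_mul_mod_self_left]
      -- The two contributing values of `r` are those congruent to `-2` modulo `N`.
      have hiff : (r + 3) % N = 1 ↔ r = N - 2 ∨ r = 2 * N - 2 := by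
        constructor
        · intro h
          have hd := Nat.mod_add_div (r + 3) N
          rw [h] at hd
          have hd0 : (r + 3) / N ≠ 0 := fun h0 => by rw [h0] at hd; omega
          have hd3 : (r + 3) / N < 3 := by
            by_contra hd3
            have := Nat.mul_le_mul_left N (not_lt.1 hd3)
            omega
          generalize (r + 3) / N = d at hd hd0 hd3
          interval_cases d <;> omega
        · rintro (rfl | rfl)
          · rw [show N - 2 + 3 = 1 + N * 1 by omega, Nat.add_mul_mod_self_left,
              Nat.mod_eq_of_lt h1]
          · rw [show 2 * N - 2 + 3 = 1 + N * 2 by omega, Nat.add_mul_mod_self_left,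
              Nat.mod_eq_of_lt h1]
      rw [hm]
      by_cases c1 : r = N - 2
      · rw [if_pos ⟨rfl, hiff.2 (Or.inl c1)⟩, if_pos c1, if_neg (by omega), add_zero]
      · by_cases c2 : r = 2 * N - 2
        · rw [if_pos ⟨rfl, hiff.2 (Or.inr c2)⟩, if_neg c1, if_pos c2, zero_add]
        · rw [if_neg fun h => (hiff.1 h.2).elim c1 c2, if_neg c1, if_neg c2, mul_zero, add_zero]
    rw [Finset.sum_congr rfl hr, Finset.sum_add_distrib, Finset.sum_ite_eq', Finset.sum_ite_eq',
      if_pos (Finset.mem_range.2 (by omega)), if_pos (Finset.mem_range.2 (by omega)), add_mul]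
  · intro m hm hm1
    rw [Finset.sum_eq_zero, mul_zero]
    intro r _
    rw [mu_mul_K_pow_mul_halfIdem h1 (Finset.mem_range.1 hm) (hX m), if_neg (by tauto), mul_zero]

/-! ### Evaluation of the Gauss sums -/

/-- The quadratic Gauss sum `∑ q ^ (- ε n² / 2)` over `ℤ / 4 N`. -/
def gaussSq (N : ℕ) (ε : ℤ) : ℂ := ∑ n ∈ Finset.range (4 * N), qpow N (ε * (-(n : ℂ) ^ 2 / 2))

lemma gaussSq_shift (N : ℕ) [NeZero N] (ε : ℤ) (c : ℕ) :
    gaussSq N ε = ∑ n ∈ Finset.range (4 * N), qpow N (ε * (-((n + c : ℕ) : ℂ) ^ 2 / 2)) := by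
  refine (sum_range_add_of_periodic (h := fun n : ℕ => qpow N (ε * (-(n : ℂ) ^ 2 / 2)))
    (fun n => qpow_congr N (-ε * (2 * n + 4 * N)) ?_) c).symm
  push_cast; ring

lemma norm_gaussSq (N : ℕ) [NeZero N] {ε : ℤ} (hε : ε ^ 2 = 1) :
    ‖gaussSq N ε‖ ^ 2 = 8 * N := by
  have hP := NeZero.pos N
  have hdvd : ∀ t : ℕ, ((4 * N : ℤ) ∣ 2 * (-ε * t) ↔ 2 * N ∣ t) := by
    intro t
    rw [show (4 * N : ℤ) = 2 * (2 * N) by ring, mul_dvd_mul_iff_left two_ne_zero,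
      ← Int.natCast_dvd_natCast]
    push_cast
    constructor
    · intro h
      have := h.mul_left (-ε)
      rwa [← mul_assoc, neg_mul_neg, ← pow_two, hε, one_mul] at this
    · exact fun h => h.mul_left _
  have hconj : (starRingEnd ℂ) (gaussSq N ε)
      = ∑ n ∈ Finset.range (4 * N), qpow N (ε * ((n : ℂ) ^ 2 / 2)) := by
    rw [gaussSq, map_sum]
    refine Finset.sum_congr rfl fun n _ => ?_
    have := conj_qpow N (ε * (-(n : ℝ) ^ 2 / 2))
    push_cast at this
    rw [this]; congr 1; ring
  -- With `m + n` in place of `m` the exponent becomes linear in `n`, and the sum over `n` leaves only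
  -- the two values `m = 0` and `m = 2 N`, for which `q ^ (- ε m² / 2) = 1`.
  have key : gaussSq N ε * (starRingEnd ℂ) (gaussSq N ε) = 8 * N := by
    rw [hconj, Finset.mul_sum]
    calc _ = ∑ n ∈ Finset.range (4 * N), ∑ m ∈ Finset.range (4 * N),
          qpow N (ε * (-(m : ℂ) ^ 2 / 2)) * qpow N ((2 * (-ε * m) : ℤ) * n / 2) := by
          refine Finset.sum_congr rfl fun n _ => ?_
          rw [gaussSq_shift N ε n, Finset.sum_mul]
          refine Finset.sum_congr rfl fun m _ => ?_
          rw [← qpow_add, ← qpow_add]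
          congr 1
          push_cast; ring
      _ = ∑ m ∈ Finset.range (2 * N + 2 * N), qpow N (ε * (-(m : ℂ) ^ 2 / 2)) *
          (if 2 * N ∣ m then (4 * N : ℂ) else 0) := by
          rw [Finset.sum_comm, show 2 * N + 2 * N = 4 * N by ring]
          refine Finset.sum_congr rfl fun m _ => ?_
          rw [← Finset.mul_sum, sum_qpow_half_mul]
          simp only [hdvd]
      _ = 8 * N := by
          have h0 : 0 ∈ Finset.range (2 * N) := Finset.mem_range.2 (by omega)
          have hz : ∀ m ∈ Finset.range (2 * N), m ≠ 0 → ¬ 2 * N ∣ m := fun m hm hm0 hd =>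
            hm0 (Nat.eq_zero_of_dvd_of_lt hd (Finset.mem_range.1 hm))
          rw [Finset.sum_range_add, Finset.sum_eq_single_of_mem 0 h0,
            Finset.sum_eq_single_of_mem 0 h0]
          · rw [if_pos (dvd_zero _), if_pos (by simp)]
            have e : qpow N (ε * (-((2 * N + 0 : ℕ) : ℂ) ^ 2 / 2)) = 1 :=
              (qpow_eq_one_iff N _).2 ⟨-ε * N, by push_cast; ring⟩
            rw [e]
            simp [qpow_zero]
            ring
          · intro m hm hm0
            rw [if_neg, mul_zero]
            rw [Nat.dvd_add_right (dvd_refl _)]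
            exact hz m hm hm0
          · intro m hm hm0
            rw [if_neg (hz m hm hm0), mul_zero]
  have h2 := congrArg norm key
  rw [norm_mul, RCLike.norm_conj, ← pow_two] at h2
  rw [h2, show (8 * N : ℂ) = ((8 * N : ℕ) : ℂ) by push_cast; rfl, Complex.norm_natCast]
  push_cast; rfl

lemma norm_one_add_of_sq_eq_neg_one {w : ℂ} (hw : w ^ 2 = -1) : ‖1 + w‖ ^ 2 = 2 := by
  have : (w - Complex.I) * (w + Complex.I) = 0 := by
    linear_combination hw - Complex.I_sq
  rcases mul_eq_zero.1 this with h | h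
  · rw [sub_eq_zero.1 h, ← Complex.normSq_eq_norm_sq]; norm_num [Complex.normSq_apply]
  · rw [eq_neg_of_add_eq_zero_left h, ← Complex.normSq_eq_norm_sq]
    norm_num [Complex.normSq_apply]

/-- The sum of the two Gauss sums which `φ^{SO(3)}` picks out. Both are multiples of the quadratic
Gauss sum by completing the square, and their quotient is a square root of `-1` as `N` is odd. -/
lemma norm_gauss_add_gauss (N : ℕ) [NeZero N] (hodd : Odd N) (h1 : 1 < N) {ε : ℤ}
    (hε : ε ^ 2 = 1) :
    ‖gauss N ε (N - 1) (2 * (N - 2)) + gauss N ε (N - 1) (2 * (2 * N - 2))‖ ^ 2 = 16 * N := by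
  have e1 : gauss N ε (N - 1) (2 * (N - 2)) = qpow N (ε / 2) * gaussSq N ε := by
    rw [gaussSq_shift N ε 1, gauss,
      Finset.mul_sum]
    refine Finset.sum_congr rfl fun n _ => ?_
    rw [← qpow_add]
    congr 1
    push_cast [Nat.cast_sub (show 2 ≤ N by omega), Nat.cast_sub h1.le]
    ring
  have e2 : gauss N ε (N - 1) (2 * (2 * N - 2))
      = qpow N (ε / 2) * gaussSq N ε * qpow N (ε * (N ^ 2 + 2 * N) / 2) := by
    rw [gaussSq_shift N ε (N + 1), gauss,
      mul_right_comm, ← qpow_add, Finset.mul_sum]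
    refine Finset.sum_congr rfl fun n _ => ?_
    rw [← qpow_add]
    refine qpow_congr N (ε * n) ?_
    push_cast [Nat.cast_sub (show 2 ≤ 2 * N by omega), Nat.cast_sub h1.le]
    ring
  have hw : qpow N (ε * (N ^ 2 + 2 * N) / 2) ^ 2 = -1 := by
    obtain ⟨b, hb⟩ := hodd
    have : Odd ε := by
      rcases sq_eq_one_iff.1 hε with rfl | rfl <;> decide
    obtain ⟨a, rfl⟩ := this
    have hb' : (N : ℂ) = 2 * b + 1 := by exact_mod_cast congrArg (Nat.cast (R := ℂ)) hb
    rw [← qpow_nat_mul, ← qpow_half_period N]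
    refine qpow_congr N (a * N + 2 * a + b + 1) ?_
    push_cast
    linear_combination (N : ℂ) * hb'
  have hn : ‖qpow N (ε / 2)‖ = 1 := by
    have := norm_qpow N (ε / 2)
    push_cast at this; exact this
  rw [e1, e2, ← mul_one_add, norm_mul, norm_mul, hn, one_mul, mul_pow, norm_gaussSq N hε,
    norm_one_add_of_sq_eq_neg_one hw]
  ring

/-! ### The modulus of the invariants -/

lemma norm_qfact_mul (N : ℕ) [NeZero N] (h1 : 1 < N) :
    ‖qfact N (N - 1)‖ * ‖qbrace N 1‖ ^ (N - 1) = N := by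
  have hq : qbrace N 1 ≠ 0 := by simpa using qbrace_ne_zero (k := 1) one_pos h1
  rw [← norm_prod_qbrace N, ← norm_pow, ← norm_mul]
  congr 1
  simp only [qfact, qint]
  rw [Finset.prod_div_distrib, Finset.prod_const, Nat.card_Icc, Nat.add_sub_cancel,
    div_mul_cancel₀ _ (pow_ne_zero _ hq)]

lemma norm_thetaCoef (N m : ℕ) {δ : ℤ} (hδ : δ ^ 2 = 1) :
    ‖thetaCoef N δ m‖ = ‖qbrace N 1‖ ^ m / ‖qfact N m‖ := by
  have h := norm_qpow N (δ * ((m : ℝ) * (m - 1) / 2))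
  push_cast at h
  have hδ' : ‖(δ : ℂ) ^ m‖ = 1 := by
    rcases sq_eq_one_iff.1 hδ with rfl | rfl <;> simp
  rw [thetaCoef, norm_mul, norm_mul, h, hδ', mul_one, one_mul, norm_div, norm_pow]

lemma norm_phiSO3_unknotSeries (N : ℕ) [NeZero N] (hodd : Odd N) (h1 : 1 < N) {δ : ℤ}
    (hδ : δ ^ 2 = 1) (X : ℕ → U N) (hK : ∀ m, Commute (U.g N .K) (X m))
    (hX : ∀ m, X m - U.g N .E ^ m * U.g N .F ^ m ∈ lowE N m) :
    ‖phiSO3 N (pr N (U.g N .K ^ (N + 1) * unknotSeries N δ X))‖ = 1 := by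
  have hN : (0 : ℝ) < N := by exact_mod_cast NeZero.pos N
  have hf : ‖qfact N (N - 1)‖ ≠ 0 := norm_ne_zero_iff.2 (qfact_ne_zero h1 (by omega))
  have hq := norm_qpow N (δ * ((2 * N + 2) * (N - 1 : ℕ)))
  push_cast at hq
  have hg : ‖gauss N (-δ) (N - 1) (2 * (N - 2)) + gauss N (-δ) (N - 1) (2 * (2 * N - 2))‖
      = Real.sqrt (16 * N) := by
    rw [← norm_gauss_add_gauss N hodd h1 (by rwa [neg_sq]), Real.sqrt_sq (norm_nonneg _)]
  have hz : ‖zeta N‖ = Real.sqrt (2 / N) * ‖qfact N (N - 1)‖ ^ 2 := by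
    rw [zeta, norm_mul, norm_neg, norm_pow, Complex.norm_real, Real.norm_of_nonneg (by positivity)]
  have hs : Real.sqrt 2 * (Real.sqrt (16 * N) * Real.sqrt (2 / N)) = 8 := by
    rw [← Real.sqrt_mul (by positivity), ← Real.sqrt_mul (by positivity),
      show 2 * (16 * N * (2 / N)) = (8 : ℝ) ^ 2 by field_simp; norm_num,
      Real.sqrt_sq (by norm_num)]
  have h4 : ‖(4 * N : ℂ)⁻¹‖ = (4 * N : ℝ)⁻¹ := by simp
  have hb := norm_qfact_mul N h1
  rw [phiSO3_unknotSeries N h1 δ X hK hX, norm_mul, norm_mul, norm_mul, norm_mul, norm_mul,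
    norm_div, hg, hz, norm_thetaCoef N _ hδ, hq, h4, Complex.norm_real,
    Real.norm_of_nonneg (by positivity), Complex.norm_two, mul_one]
  calc _ = (Real.sqrt 2 * (Real.sqrt (16 * N) * Real.sqrt (2 / N)))
        * (‖qfact N (N - 1)‖ * ‖qbrace N 1‖ ^ (N - 1)) / (8 * N) := by
        field_simp
        ring
    _ = 1 := by rw [hs, hb]; field_simp

lemma U.K_commute_E_pow_mul_F_pow (N m : ℕ) :
    Commute (U.g N .K) (U.g N .E ^ m * U.g N .F ^ m) := by
  rw [Commute, SemiconjBy, ← mul_assoc, mul_pow_of_mul (U.K_mul_E N), smul_mul_assoc, mul_assoc,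
    mul_pow_of_mul (U.K_mul_F N), mul_smul_comm, smul_smul, ← mul_pow, ← qpow_add,
    add_neg_cancel, qpow_zero, one_pow, one_smul, mul_assoc]

lemma U.K_commute_F_pow_mul_E_pow (N m : ℕ) :
    Commute (U.g N .K) (U.g N .F ^ m * U.g N .E ^ m) := by
  rw [Commute, SemiconjBy, ← mul_assoc, mul_pow_of_mul (U.K_mul_F N), smul_mul_assoc, mul_assoc,
    mul_pow_of_mul (U.K_mul_E N), mul_smul_comm, smul_smul, ← mul_pow, ← qpow_add,
    neg_add_cancel, qpow_zero, one_pow, one_smul, mul_assoc]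

end

end SmallQuantum

theorem lemma5 (N : ℕ) [NeZero N] (hodd : Odd N) (hN : 1 < N) :
    ∃ uP uM : SmallQuantum.U N,
      SmallQuantum.incl N uP = SmallQuantum.uTildePlus N ∧
      SmallQuantum.incl N uM = SmallQuantum.uTildeMinus N ∧
      ‖SmallQuantum.phiSO3 N (SmallQuantum.pr N uP)‖ = 1 ∧
      ‖SmallQuantum.phiSO3 N (SmallQuantum.pr N uM)‖ = 1 ∧
      SmallQuantum.phiSO3 N (SmallQuantum.pr N uP) ≠ 0 ∧
      SmallQuantum.phiSO3 N (SmallQuantum.pr N uM) ≠ 0 := by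
  have hP := SmallQuantum.norm_phiSO3_unknotSeries N hodd hN (δ := 1) (by norm_num)
    (fun m => SmallQuantum.U.g N .F ^ m * SmallQuantum.U.g N .E ^ m)
    (SmallQuantum.U.K_commute_F_pow_mul_E_pow N)
    (fun m => SmallQuantum.F_pow_mul_E_pow_sub_mem_lowE N m m)
  have hM := SmallQuantum.norm_phiSO3_unknotSeries N hodd hN (δ := -1) (by norm_num)
    (fun m => SmallQuantum.U.g N .E ^ m * SmallQuantum.U.g N .F ^ m)
    (SmallQuantum.U.K_commute_E_pow_mul_F_pow N)
    (fun m => by rw [sub_self]; exact Submodule.zero_mem _)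
  refine ⟨_, _, ?_, ?_, hP, hM, ?_, ?_⟩
  · rw [map_mul, map_pow, SmallQuantum.incl_g, SmallQuantum.incl_unknotSeries_eq_uPlus]
    rfl
  · rw [map_mul, map_pow, SmallQuantum.incl_g, SmallQuantum.incl_unknotSeries_eq_uMinus N hN]
    rfl
  · rw [← norm_ne_zero_iff, hP]; exact one_ne_zero
  · rw [← norm_ne_zero_iff, hM]; exact one_ne_zero
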